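/- **Problem.** Let $\mathcal E,\mathcal I$ be finite index sets, $m=|\mathcal E|+|\mathcal I|$, and consider $\min f(x)$ subject to $c_i(x)=0$ $(i\in\mathcal E)$, $c_i(x)\ge 0$ $(i\in\mathcal I)$, $x\in\mathbb R^n$, with feasible region $\Omega$. Let $D\subset\mathbb R^n$ be compact and convex with $\Omega\subseteq D\subseteq O$, $O$ open. Assume that $f$ is real-valued, Lipschitz continuous and upper-$\mathcal C^2$ on $O$ (near each point of $O$ it is a minimum over a compact index space of $\mathcal C^2$ functions that are, with their derivatives of order $\le 2$, jointly continuous in the index and the point), and let $\rho>0$ be such that $-f+\frac{\rho}{2}\|\cdot\|^2$ is convex on $D$. The $c_i:\mathbb R^n\to\mathbb R$ are twice continuously differentiable, and $H\ge 0$ satisfies $|c_i(x')-c_i(x)-\nabla c_i(x)^T(x'-x)|\le\frac H2\|x-x'\|^2$ for all $x,x'\in D$ and all $i$. Put $c_h=mH$. **Algorithm.** Let $\eta,\tau\in(0,1)$, $\gamma>0$, $\theta_0>0$. At iteration $k$ take a Clarke subgradient $g_k\in\bar\partial f(x_k)$ and a symmetric matrix $B_k$, and let $(d_k,v^k,w^k,t^k)$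 be a solution, with Lagrange multiplier $\lambda^{k+1}\in\mathbb R^m$ for the linearized constraints, of $$\min_{d,v,w,t}\ f(x_k)+g_k^Td+\tfrac12 d^TB_kd+\theta_k\sum_{i\in\mathcal E}(v_i+w_i)+\theta_k\sum_{i\in\mathcal I}t_i$$ subject to $c_i(x_k)+\nabla c_i(x_k)^Td=v_i-w_i$ $(i\in\mathcal E)$, $c_i(x_k)+\nabla c_i(x_k)^Td\ge -t_i$ $(i\in\mathcal I)$, $v,w,t\ge0$. Set $\theta_{k+1}=\max\{\theta_k,\|\lambda^{k+1}\|_\infty+\gamma\}$. With $v(x)=\sum_{i\in\mathcal E}|c_i(x)|+\sum_{i\in\mathcal I}\max\{0,-c_i(x)\}$ and $\phi(x,\theta)=f(x)+\theta v(x)$, let $\alpha_k$ be the first of $1,\tau,\tau^2,\dots$ for which $\phi(x_k,\theta_k)-\phi(x_k+\alpha_kd_k,\theta_k)\ge\eta\,\alpha_k\frac12d_k^TB_kd_k$, and set $x_{k+1}=x_k+\alpha_kd_k$. Consider an infinite run: for no $k$ do both $d_k=0$ and $v(x_k)=0$ hold. **Assumptions on the run.** For all $k$: $x_k\in D$ and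 $x_k+d_k\in D$. The $B_k$ are bounded, and $d^TB_kd\ge b\|d\|^2$ for all $k$ and $d$, with a constant $b>0$. Every accumulation point $\hat x$ of $\{x_k\}$ is feasible and satisfies MFCQ: the $\nabla c_i(\hat x)$, $i\in\mathcal E$, are linearly independent, and there is $w\in\mathbb R^n$ with $\nabla c_i(\hat x)^Tw=0$ for $i\in\mathcal E$ and $\nabla c_i(\hat x)^Tw>0$ for all $i\in\mathcal I$ with $c_i(\hat x)=0$. There is $c_b\in(0,1)$ with $c_b b-\theta_kc_h\ge0$ for all $k$ large enough. **Potential function.** Let $\sigma$ and $l>0$ satisfy $2b\ge l+\sigma$ and $l/c_b>b\ge\sigma\ge\rho$. Let $F(x)=-f(x)+\frac\sigma2\|x\|^2$ for $x\in D$ and $F(x)=+\infty$ otherwise, let $F^*$ be its convex conjugate, and $$L(x,y,w)=-y^Tx+F^*(y)+\tfrac\sigma2\|x\|^2+\tfrac l2\|x-w\|^2+i_{\bar C}(x,w),$$ where $i_{\bar C}$ is the indicator function ($0$ on $\bar C$, $+\infty$ elsewhere) of the set $\bar C$ of all $(x,w)$ such that $c_i(w)+\nabla c_i(w)^T(x-w)$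 is $=0$ for $i\in\mathcal E$ and $\ge0$ for $i\in\mathcal I$. Suppose that $L$ is a KL function with exponent $\alpha\in(0,\frac12]$: for every $\hat u$ at which the limiting subdifferential $\partial L(\hat u)$ is nonempty there are $a_0>0$, $\bar\eta\in(0,\infty]$ and a neighborhood $U$ of $\hat u$ such that, with $\varphi(s)=a_0s^{1-\alpha}$, $\varphi'(L(u)-L(\hat u))\,\mathrm{dist}(0,\partial L(u))\ge1$ whenever $u\in U$ and $L(\hat u)<L(u)<L(\hat u)+\bar\eta$ (with $\mathrm{dist}(0,\emptyset)=+\infty$). **Conclusion.** The sequence $\{x_k\}$ converges to a point $\bar x$, and there are $q_0\in(0,1)$ and $q_1>0$ such that $\|x_k-\bar x\|\le q_1q_0^k$ for all $k$ large enough. -/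

import Mathlib

open Filter Topology

noncomputable section

namespace NonsmoothSQP

/-- `ℝⁿ` with the Euclidean norm and inner product. -/
abbrev Vec (n : ℕ) : Type := EuclideanSpace ℝ (Fin n)

/-! ### Variational analysis -/

section Variational

variable {V : Type*} [NormedAddCommGroup V] [InnerProductSpace ℝ V]

/-- The Clarke subdifferential, through the generalized directional derivative
`f°(x; v) = limsup_{y → x, t ↓ 0} (f (y + t v) - f y) / t`, taken in the extended reals. -/
def clarkeSubdiff (f : V → ℝ) (x : V) : Set V :=
  {g | ∀ v : V, ((inner ℝ g v : ℝ) : EReal) ≤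
    limsup (fun q : V × ℝ => (((f (q.1 + q.2 • v) - f q.1) / q.2 : ℝ) : EReal))
      (𝓝 x ×ˢ 𝓝[>] (0 : ℝ))}

/-- `f` is upper-`C²` on `O`: near every point of `O` it is a pointwise minimum of a compact family
of `C²` functions which, with their derivatives up to order two, are jointly continuous in the
parameter and the point. -/
def UpperC2On (f : V → ℝ) (O : Set V) : Prop :=
  ∀ a ∈ O, ∃ W : Set V, IsOpen W ∧ a ∈ W ∧
    ∃ (T : Type) (_ : TopologicalSpace T) (_ : CompactSpace T) (p : T → V → ℝ),
      (∀ t, ContDiffOn ℝ 2 (p t) W) ∧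
      ContinuousOn (fun q : T × V => p q.1 q.2) (Set.univ ×ˢ W) ∧
      ContinuousOn (fun q : T × V => fderiv ℝ (p q.1) q.2) (Set.univ ×ˢ W) ∧
      ContinuousOn (fun q : T × V => iteratedFDeriv ℝ 2 (p q.1) q.2) (Set.univ ×ˢ W) ∧
      ∀ x ∈ W, IsLeast (Set.range fun t => p t x) (f x)

/-- The (lower) regular subdifferential of an extended-real-valued function at a point where it is
finite. The displayed inequality says that
`liminf_{z → x, z ≠ x} (f z - f x - ⟪g, z - x⟫) / ‖z - x‖ ≥ 0`. -/
def regularSubdiff (f : V → EReal) (x : V) : Set V :=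
  {g | f x ≠ ⊤ ∧ f x ≠ ⊥ ∧ ∀ ε : ℝ, 0 < ε → ∀ᶠ z in 𝓝 x,
    f x + ((inner ℝ g (z - x) - ε * ‖z - x‖ : ℝ) : EReal) ≤ f z}

/-- The (lower) general, or limiting, subdifferential: limits of regular subgradients along
sequences with `x^ν → x` and `f (x^ν) → f x`. -/
def generalSubdiff (f : V → EReal) (x : V) : Set V :=
  {g | f x ≠ ⊤ ∧ f x ≠ ⊥ ∧ ∃ (z s : ℕ → V), Tendsto z atTop (𝓝 x) ∧
    Tendsto (fun ν => f (z ν)) atTop (𝓝 (f x)) ∧ (∀ ν, s ν ∈ regularSubdiff f (z ν)) ∧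
    Tendsto s atTop (𝓝 g)}

/-- The convex conjugate `F^*(u) = sup_x (⟪u, x⟫ - F x)`. -/
def conjugate (F : V → EReal) (u : V) : EReal :=
  ⨆ x : V, ((inner ℝ u x : ℝ) : EReal) - F x

open Classical in
/-- The indicator function of a set: `0` on the set and `+∞` off it. -/
def indicatorFn {W : Type*} (S : Set W) (x : W) : EReal := if x ∈ S then 0 else ⊤

/-- The requirements on a desingularizing function on `[0, η)`, where `η ∈ (0, ∞]`. -/
structure IsDesingularizing (φ : ℝ → ℝ) (η : EReal) : Prop where
  zero : φ 0 = 0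
  nonneg : ∀ s : ℝ, 0 ≤ s → (s : EReal) < η → 0 ≤ φ s
  continuousOn : ContinuousOn φ {s : ℝ | 0 ≤ s ∧ (s : EReal) < η}
  concaveOn : ConcaveOn ℝ {s : ℝ | 0 ≤ s ∧ (s : EReal) < η} φ
  contDiffOn : ContDiffOn ℝ 1 φ {s : ℝ | 0 < s ∧ (s : EReal) < η}
  deriv_pos : ∀ s : ℝ, 0 < s → (s : EReal) < η → 0 < deriv φ s

/-- The Kurdyka-Łojasiewicz property of `f` at `a` with desingularizing function `φ`. The distance
from `0` to an empty subdifferential is `+∞`. -/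
def HasKLWith (f : V → EReal) (a : V) (φ : ℝ → ℝ) : Prop :=
  ∃ η : EReal, 0 < η ∧ IsDesingularizing φ η ∧ ∃ U ∈ 𝓝 a,
    ∀ x ∈ U, f a < f x → f x < f a + η →
      1 ≤ ENNReal.ofReal (deriv φ ((f x).toReal - (f a).toReal)) *
        Metric.infEDist (0 : V) (generalSubdiff f x)

/-- `f` is a KL function with exponent `κ`: at every point of `dom ∂f` it has the KL property with
a desingularizing function `s ↦ a₀ s ^ (1 - κ)`. -/
def IsKLWithExponent (f : V → EReal) (κ : ℝ) : Prop :=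
  ∀ a : V, (generalSubdiff f a).Nonempty →
    ∃ a₀ : ℝ, 0 < a₀ ∧ HasKLWith f a (fun s => a₀ * s ^ (1 - κ))

end Variational

/-! ### The constrained problem

The constraints are `c (Sum.inl i) x = 0` for `i : E` and `0 ≤ c (Sum.inr i) x` for `i : I`. -/

section Problem

variable {n : ℕ} {E I : Type*}

/-- The feasible region `Ω`. -/
def feasibleRegion (c : E ⊕ I → Vec n → ℝ) : Set (Vec n) :=
  {x | (∀ i : E, c (Sum.inl i) x = 0) ∧ ∀ i : I, 0 ≤ c (Sum.inr i) x}

/-- The Mangasarian-Fromovitz constraint qualification at a (feasible) point `x`. -/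
def MFCQ (c : E ⊕ I → Vec n → ℝ) (x : Vec n) : Prop :=
  x ∈ feasibleRegion c ∧
  LinearIndependent ℝ (fun i : E => gradient (c (Sum.inl i)) x) ∧
  ∃ w : Vec n,
    (∀ i : I, c (Sum.inr i) x = 0 → 0 < inner ℝ (gradient (c (Sum.inr i)) x) w) ∧
    ∀ i : E, inner ℝ (gradient (c (Sum.inl i)) x) w = 0

/-- The linearized constraint `c̄ᵢ(x, w) = cᵢ(w) + ∇cᵢ(w)ᵀ (x - w)`. -/
def linCon (c : E ⊕ I → Vec n → ℝ) (i : E ⊕ I) (x w : Vec n) : ℝ :=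
  c i w + inner ℝ (gradient (c i) w) (x - w)

/-- The set `C̄` of pairs `(x, w)` satisfying the linearized constraints. -/
def linFeasible (c : E ⊕ I → Vec n → ℝ) : Set (Vec n × Vec n) :=
  {q | (∀ i : E, linCon c (Sum.inl i) q.1 q.2 = 0) ∧
    ∀ i : I, 0 ≤ linCon c (Sum.inr i) q.1 q.2}

open Classical in
/-- `F = -f + (σ/2) ‖·‖²` on `D` and `+∞` off `D`. -/
def convexPart (f : Vec n → ℝ) (D : Set (Vec n)) (σ : ℝ) (x : Vec n) : EReal :=
  if x ∈ D then ((-f x + σ / 2 * ‖x‖ ^ 2 : ℝ) : EReal) else ⊤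

/-- The potential function
`L(x, y, w) = -yᵀx + F^*(y) + (σ/2) ‖x‖² + (l/2) ‖x - w‖² + i_C̄(x, w)` on `ℝⁿ × ℝⁿ × ℝⁿ`
(with its Euclidean structure), where `(x, y, w) = (u 0, u 1, u 2)`. -/
def potential (f : Vec n → ℝ) (c : E ⊕ I → Vec n → ℝ) (D : Set (Vec n)) (σ l : ℝ)
    (u : PiLp 2 (fun _ : Fin 3 => Vec n)) : EReal :=
  ((-inner ℝ (u 1) (u 0) : ℝ) : EReal) + conjugate (convexPart f D σ) (u 1)
    + ((σ / 2 * ‖u 0‖ ^ 2 : ℝ) : EReal) + ((l / 2 * ‖u 0 - u 2‖ ^ 2 : ℝ) : EReal)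
    + indicatorFn (linFeasible c) (u 0, u 2)

variable [Fintype E] [Fintype I]

/-- The constraint violation `v(x) = ∑_E |cᵢ(x)| + ∑_I max(0, -cᵢ(x))`. -/
def violation (c : E ⊕ I → Vec n → ℝ) (x : Vec n) : ℝ :=
  (∑ i : E, |c (Sum.inl i) x|) + ∑ i : I, max 0 (-c (Sum.inr i) x)

/-- The `ℓ₁` merit function `φ(x, θ) = f(x) + θ v(x)`. -/
def merit (f : Vec n → ℝ) (c : E ⊕ I → Vec n → ℝ) (x : Vec n) (θ : ℝ) : ℝ :=
  f x + θ * violation c x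

/-- Feasibility of `(d, v, w, t)` for the relaxed quadratic subproblem at `x`. -/
def QPFeasible (c : E ⊕ I → Vec n → ℝ) (x d : Vec n) (v w : E → ℝ) (t : I → ℝ) : Prop :=
  (∀ i : E, c (Sum.inl i) x + inner ℝ (gradient (c (Sum.inl i)) x) d = v i - w i) ∧
  (∀ i : I, -t i ≤ c (Sum.inr i) x + inner ℝ (gradient (c (Sum.inr i)) x) d) ∧
  (∀ i, 0 ≤ v i) ∧ (∀ i, 0 ≤ w i) ∧ ∀ i, 0 ≤ t i

/-- The objective of the relaxed quadratic subproblem at `x`, with model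
`f(x) + gᵀd + (1/2) dᵀBd` and penalty parameter `θ`. -/
def qpObjective (f : Vec n → ℝ) (x g : Vec n) (B : Vec n →L[ℝ] Vec n) (θ : ℝ)
    (d : Vec n) (v w : E → ℝ) (t : I → ℝ) : ℝ :=
  f x + inner ℝ g d + 1 / 2 * inner ℝ d (B d) + θ * (∑ i, (v i + w i)) + θ * ∑ i, t i

/-- `(d, v, w, t)` solves the relaxed quadratic subproblem at `x`. -/
def IsQPSolution (f : Vec n → ℝ) (c : E ⊕ I → Vec n → ℝ) (x g : Vec n)
    (B : Vec n →L[ℝ] Vec n) (θ : ℝ) (d : Vec n) (v w : E → ℝ) (t : I → ℝ) : Prop :=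
  QPFeasible c x d v w t ∧
  ∀ (d' : Vec n) (v' w' : E → ℝ) (t' : I → ℝ), QPFeasible c x d' v' w' t' →
    qpObjective f x g B θ d v w t ≤ qpObjective f x g B θ d' v' w' t'

/-- `mult` is a Lagrange multiplier of the relaxed quadratic subproblem at its solution
`(d, v, w, t)`: the first-order optimality conditions hold, with multipliers `p, q, r` for the
bounds `v, w, t ≥ 0`. -/
def IsQPMultiplier (c : E ⊕ I → Vec n → ℝ) (x g : Vec n) (B : Vec n →L[ℝ] Vec n) (θ : ℝ)
    (d : Vec n) (v w : E → ℝ) (t : I → ℝ) (mult : E ⊕ I → ℝ) : Prop :=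
  g + B d - ∑ i : E ⊕ I, mult i • gradient (c i) x = 0 ∧
  (∀ i : I, mult (Sum.inr i) *
    (c (Sum.inr i) x + inner ℝ (gradient (c (Sum.inr i)) x) d + t i) = 0) ∧
  (∀ i : I, 0 ≤ mult (Sum.inr i)) ∧
  ∃ (p q : E → ℝ) (r : I → ℝ),
    (∀ i, θ + mult (Sum.inl i) - p i = 0) ∧ (∀ i, θ - mult (Sum.inl i) - q i = 0) ∧
    (∀ i, θ - mult (Sum.inr i) - r i = 0) ∧
    (∀ i, p i * v i = 0) ∧ (∀ i, q i * w i = 0) ∧ (∀ i, r i * t i = 0) ∧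
    (∀ i, 0 ≤ p i) ∧ (∀ i, 0 ≤ q i) ∧ ∀ i, 0 ≤ r i

/-- The line search condition for the step size `a`. -/
def LineSearchCond (f : Vec n → ℝ) (c : E ⊕ I → Vec n → ℝ) (η θ : ℝ) (x d : Vec n)
    (B : Vec n →L[ℝ] Vec n) (a : ℝ) : Prop :=
  η * a * (1 / 2 * inner ℝ d (B d)) ≤ merit f c x θ - merit f c (x + a • d) θ

/-- An infinite run of the nonsmooth SQP algorithm with parameters `η, τ, γ` and zero stopping
tolerances. `mult (k + 1)` is the multiplier found at iteration `k`; the norm of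
`mult (k + 1) : E ⊕ I → ℝ` is the maximum norm. -/
structure IsSQPRun (f : Vec n → ℝ) (c : E ⊕ I → Vec n → ℝ) (η τ γ : ℝ)
    (x g d : ℕ → Vec n) (B : ℕ → Vec n →L[ℝ] Vec n) (v w : ℕ → E → ℝ) (t : ℕ → I → ℝ)
    (mult : ℕ → E ⊕ I → ℝ) (θ a : ℕ → ℝ) : Prop where
  penalty_pos : 0 < θ 0
  subgradient : ∀ k, g k ∈ clarkeSubdiff f (x k)
  symmetric : ∀ k, IsSelfAdjoint (B k)
  qp_solution : ∀ k, IsQPSolution f c (x k) (g k) (B k) (θ k) (d k) (v k) (w k) (t k)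
  qp_multiplier : ∀ k,
    IsQPMultiplier c (x k) (g k) (B k) (θ k) (d k) (v k) (w k) (t k) (mult (k + 1))
  not_stopped : ∀ k, ¬ (‖d k‖ ≤ 0 ∧ violation c (x k) ≤ 0)
  penalty_update : ∀ k, θ (k + 1) = max (θ k) (‖mult (k + 1)‖ + γ)
  line_search : ∀ k, ∃ j : ℕ, a k = τ ^ j ∧
    LineSearchCond f c η (θ k) (x k) (d k) (B k) (τ ^ j) ∧
    ∀ i < j, ¬ LineSearchCond f c η (θ k) (x k) (d k) (B k) (τ ^ i)
  step : ∀ k, x (k + 1) = x k + a k • d k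

end Problem

end NonsmoothSQP

end

/-! The proof compares two quantities, both controlled by the steps `d k`: the merit function at a
fixed penalty, which decreases, and the potential `L`, which satisfies the KL inequality.

MFCQ bounds the multipliers (`eventually_norm_multiplier_le`), so the penalties increase to a finite
limit `Θ`. The margin `γ` keeps multipliers below `Θ - γ`, hence eventually below `θ k`. Then all
slacks vanish and every subproblem satisfies the linearized constraints exactly.

Put `Φ k = f (x k) + Θ * violation c (x k)` and `S k = Θ * violation c (x k) - ⟪g k, d k⟫ - ⟪d k, B
k (d k)⟫`. Complementarity gives `S k ≥ γ * violation c (x k)`. Quadratic upper bounds for `f` and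
the constraints, with step sizes bounded below, show that `Φ k - Φ (k + 1)` dominates a multiple of
`‖d k‖ ^ 2 + S k`. Hence `d k` and the violation tend to zero, and `f (x k)` has the same limit as
`Φ`.

At `(x + d, σ x - g, x)` Fenchel equality reduces `L` to `f x + ⟪g, d⟫ + (σ + l) / 2 * ‖d‖ ^ 2`, and
`L` has a regular subgradient there of norm `O(‖d‖)`. With exponent at most `1/2`, KL bounds the
excess of this value over its limit by `O(‖d‖ ^ 2)` (`IsKLWithExponent.exists_quadratic_bound`,
`exists_potential_bound`). Since `Φ` differs from it only by `S` and quadratic terms, the excess of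
`Φ` over its limit is at most a multiple of its own next decrease. So `Φ` converges geometrically,
and the steps are summed by `exists_tendsto_of_linear_decrease`. -/

noncomputable section

namespace NonsmoothSQP

/-! ### Clarke subgradients of upper-`C²` functions -/

section Variational
variable {V : Type*} [NormedAddCommGroup V] [InnerProductSpace ℝ V]

/-- A `C²` function whose second derivative is bounded on a ball has a quadratic remainder there. -/
theorem taylor_le_of_norm_iteratedFDeriv_two_le {p : V → ℝ} {W : Set V} (hW : IsOpen W)
    (hp : ContDiffOn ℝ 2 p W) {a : V} {δ r : ℝ} (hδ : Metric.ball a δ ⊆ W)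
    (hr : ∀ x ∈ Metric.ball a δ, ‖iteratedFDeriv ℝ 2 p x‖ ≤ r)
    {m y : V} (hm : m ∈ Metric.ball a δ) (hy : y ∈ Metric.ball a δ) :
    p y ≤ p m + fderiv ℝ p m (y - m) + r * ‖y - m‖ ^ 2 := by
  have hconv := convex_ball a δ
  have hd1 : ∀ z ∈ Metric.ball a δ, DifferentiableAt ℝ p z := fun z hz =>
    (hp.contDiffAt (hW.mem_nhds (hδ hz))).differentiableAt (by norm_num)
  have hd2 : ∀ z ∈ Metric.ball a δ, DifferentiableAt ℝ (fderiv ℝ p) z := fun z hz =>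
    ((hp.contDiffAt (hW.mem_nhds (hδ hz))).fderiv_right (m := 1) (by norm_num)).differentiableAt
      (by norm_num)
  have hb2 : ∀ z ∈ Metric.ball a δ, ‖fderiv ℝ (fderiv ℝ p) z‖ ≤ r := by
    intro z hz
    rw [← norm_iteratedFDeriv_one, norm_iteratedFDeriv_fderiv]
    exact hr z hz
  have hseg : segment ℝ m y ⊆ Metric.ball a δ := hconv.segment_subset hm hy
  have hlip : ∀ z ∈ segment ℝ m y, ‖fderiv ℝ p z - fderiv ℝ p m‖ ≤ r * ‖y - m‖ := by
    intro z hz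
    have h1 := hconv.norm_image_sub_le_of_norm_fderiv_le hd2 hb2 hm (hseg hz)
    have hr0 : 0 ≤ r := (norm_nonneg _).trans (hr m hm)
    have h2 : ‖z - m‖ ≤ ‖y - m‖ := by
      simpa [norm_sub_rev] using norm_sub_le_of_mem_segment hz
    exact h1.trans (mul_le_mul_of_nonneg_left h2 hr0)
  -- The mean value inequality for `p` minus its tangent at `m` gives the constant `r` in place of
  -- the sharp `r / 2`; any constant suffices here.
  have h3 := (convex_segment m y).norm_image_sub_le_of_norm_fderiv_le' (𝕜 := ℝ)
    (fun z hz => hd1 z (hseg hz)) hlip (left_mem_segment ℝ m y) (right_mem_segment ℝ m y)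
  have h4 := (le_abs_self _).trans h3
  nlinarith [h4]

/-- Upper-`C²` functions are locally below a quadratic perturbation of a tangent. -/
theorem UpperC2On.exists_quadratic_upper_bound {f : V → ℝ} {O : Set V} (hf : UpperC2On f O)
    {a : V} (ha : a ∈ O) :
    ∃ r δ : ℝ, 0 ≤ r ∧ 0 < δ ∧ ∀ m ∈ Metric.ball a δ, ∃ ℓ : V →L[ℝ] ℝ,
      ∀ y ∈ Metric.ball a δ, f y ≤ f m + ℓ (y - m) + r * ‖y - m‖ ^ 2 := by
  obtain ⟨W, hW, haW, T, _, _, p, hp, -, -, hp2, hmin⟩ := hf a ha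
  have hcont : ∀ t, ContinuousAt (fun q : T × V => iteratedFDeriv ℝ 2 (p q.1) q.2) (t, a) :=
    fun t => hp2.continuousAt ((isOpen_univ.prod hW).mem_nhds ⟨trivial, haW⟩)
  have hca : Continuous fun t => ‖iteratedFDeriv ℝ 2 (p t) a‖ := by
    refine (continuous_iff_continuousAt.2 fun t => ?_).norm
    exact (hcont t).comp (f := fun t : T => (t, a)) (by fun_prop)
  obtain ⟨M, hM⟩ := (isCompact_range hca).bddAbove
  have hbound : ∀ᶠ x in 𝓝 a, ∀ t ∈ (Set.univ : Set T), ‖iteratedFDeriv ℝ 2 (p t) x‖ ≤ M + 1 := by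
    refine isCompact_univ.eventually_forall_of_forall_eventually fun t _ => ?_
    have h1 : Tendsto (fun q : V × T => ‖iteratedFDeriv ℝ 2 (p q.2) q.1‖) (𝓝 (a, t))
        (𝓝 ‖iteratedFDeriv ℝ 2 (p t) a‖) :=
      ((hcont t).comp_of_eq (f := fun q : V × T => (q.2, q.1)) (by fun_prop) rfl).norm
    have h2 : ‖iteratedFDeriv ℝ 2 (p t) a‖ < M + 1 := by
      have := hM ⟨t, rfl⟩
      linarith
    exact (h1.eventually_lt_const h2).mono fun q hq => hq.le
  obtain ⟨δ, hδ, hball⟩ := Metric.mem_nhds_iff.1 (inter_mem hbound (hW.mem_nhds haW))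
  refine ⟨max (M + 1) 0, δ, le_max_right _ _, hδ, fun m hm => ?_⟩
  -- A member of the family active at `m` touches `f` at `m` and lies above it nearby, so its Taylor
  -- bound passes to `f`. Compactness of `T` made the constant independent of `t`.
  obtain ⟨⟨t, ht⟩, -⟩ := hmin m (hball hm).2
  refine ⟨fderiv ℝ (p t) m, fun y hy => ?_⟩
  have h1 := taylor_le_of_norm_iteratedFDeriv_two_le (r := max (M + 1) 0) hW (hp t)
    (fun z hz => (hball hz).2) (fun z hz => ((hball hz).1 t trivial).trans (le_max_left _ _)) hm hy
  have h2 := (hmin y (hball hy).2).2 ⟨t, rfl⟩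
  simp only at ht h2
  rw [ht] at h1
  exact h2.trans h1

/-- At a Clarke subgradient, an upper-`C²` function has a one-sided quadratic upper bound along
every direction. -/
theorem UpperC2On.eventually_le_of_mem_clarkeSubdiff {f : V → ℝ} {O : Set V} (hf : UpperC2On f O)
    (hO : IsOpen O) (hcont : ContinuousOn f O) {a g : V} (ha : a ∈ O) (hg : g ∈ clarkeSubdiff f a)
    (v : V) :
    ∃ r : ℝ, ∀ᶠ s in 𝓝[>] (0 : ℝ), f (a + s • v) ≤ f a + s * inner ℝ g v + r * s ^ 2 := by
  obtain ⟨r, δ, hr, hδ, hq⟩ := hf.exists_quadratic_upper_bound ha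
  refine ⟨r * ‖v‖ ^ 2, ?_⟩
  have hlim : Tendsto (fun S : ℝ => a + S • v) (𝓝[>] 0) (𝓝 a) := by
    have : Tendsto (fun S : ℝ => a + S • v) (𝓝 0) (𝓝 (a + (0 : ℝ) • v)) := by
      apply Continuous.tendsto; fun_prop
    simpa using this.mono_left nhdsWithin_le_nhds
  filter_upwards [hlim.eventually (inter_mem (Metric.ball_mem_nhds a hδ) (hO.mem_nhds ha)),
    self_mem_nhdsWithin] with S hS hS0
  have hS0 : 0 < S := hS0
  have hfc : ∀ {z : V}, z ∈ O → ContinuousAt f z := fun hz => hcont.continuousAt (hO.mem_nhds hz)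
  set F : Filter (V × ℝ) := 𝓝 a ×ˢ 𝓝[>] (0 : ℝ) with hF
  have hz : Tendsto (fun q : V × ℝ => q.1 + q.2 • (-v)) F (𝓝 a) := by
    have : Tendsto (fun q : V × ℝ => q.1 + q.2 • (-v)) (𝓝 (a, (0 : ℝ)))
        (𝓝 (a + (0 : ℝ) • (-v))) := by
      apply Continuous.tendsto (f := fun q : V × ℝ => q.1 + q.2 • (-v)); fun_prop
    rw [nhds_prod_eq] at this
    simpa using this.mono_left (prod_mono le_rfl nhdsWithin_le_nhds)
  have hzS : Tendsto (fun q : V × ℝ => q.1 + q.2 • (-v) + S • v) F (𝓝 (a + S • v)) :=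
    hz.add_const _
  have hs : ∀ᶠ q in F, 0 < q.2 ∧ q.2 < S := by
    have h1 : ∀ᶠ s in 𝓝[>] (0 : ℝ), 0 < s ∧ s < S := Ioo_mem_nhdsGT hS0
    exact (tendsto_snd (f := 𝓝 a)).eventually h1
  have hlim2 : Tendsto (fun q : V × ℝ =>
      ((-((f (q.1 + q.2 • (-v) + S • v) - f (q.1 + q.2 • (-v))) / S - r * ‖v‖ ^ 2 * S) : ℝ) :
        EReal)) F (𝓝 ((-((f (a + S • v) - f a) / S - r * ‖v‖ ^ 2 * S) : ℝ) : EReal)) := by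
    refine (continuous_coe_real_ereal.tendsto _).comp ?_
    exact (((((hfc hS.2).tendsto.comp hzS).sub ((hfc ha).tendsto.comp hz)).div_const S).sub_const
      _).neg
  have hle : limsup (fun q : V × ℝ => (((f (q.1 + q.2 • (-v)) - f q.1) / q.2 : ℝ) : EReal)) F ≤
      ((-((f (a + S • v) - f a) / S - r * ‖v‖ ^ 2 * S) : ℝ) : EReal) := by
    rw [← hlim2.limsup_eq]
    refine limsup_le_limsup ?_
    filter_upwards [hs, hz.eventually (Metric.ball_mem_nhds a hδ),
      hzS.eventually (Metric.isOpen_ball.mem_nhds hS.1),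
      (tendsto_fst (g := 𝓝[>] (0 : ℝ))).eventually (Metric.ball_mem_nhds a hδ)]
      with q ⟨hq0, hqS⟩ hqz hqzS hqb
    obtain ⟨ℓ, hℓ⟩ := hq q.1 hqb
    have h1 := hℓ _ hqz
    have h2 := hℓ _ hqzS
    rw [show q.1 + q.2 • (-v) - q.1 = (-q.2) • v by simp, norm_smul] at h1
    rw [show q.1 + q.2 • (-v) + S • v - q.1 = (S - q.2) • v by rw [sub_smul]; simp; abel,
      norm_smul] at h2
    simp only [map_smul, smul_eq_mul, Real.norm_eq_abs, mul_pow, sq_abs] at h1 h2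
    rw [EReal.coe_le_coe_iff]
    -- Approximate concavity at three collinear points: `q.1` is the average of the other two with
    -- weights proportional to `S - q.2` and `q.2`, so the unknown linear term `ℓ` cancels. This
    -- bounds the short quotient in direction `-v` by the quotient over the fixed length `S`.
    have key : (S - q.2) * f (q.1 + q.2 • (-v)) + q.2 * f (q.1 + q.2 • (-v) + S • v) ≤
        S * f q.1 + r * ‖v‖ ^ 2 * (q.2 * S * (S - q.2)) := by
      have := mul_le_mul_of_nonneg_left h1 (sub_nonneg.2 hqS.le)
      have := mul_le_mul_of_nonneg_left h2 hq0.le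
      linarith
    have h5 : 0 ≤ r * ‖v‖ ^ 2 * (q.2 * S * q.2) := by positivity
    rw [← sub_nonneg]
    have h6 : -((f (q.1 + q.2 • (-v) + S • v) - f (q.1 + q.2 • (-v))) / S - r * ‖v‖ ^ 2 * S) -
        (f (q.1 + q.2 • (-v)) - f q.1) / q.2 =
        (S * f q.1 + r * ‖v‖ ^ 2 * (q.2 * S * (S - q.2)) + r * ‖v‖ ^ 2 * (q.2 * S * q.2) -
        ((S - q.2) * f (q.1 + q.2 • (-v)) + q.2 * f (q.1 + q.2 • (-v) + S • v))) / (S * q.2) := by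
      field_simp
      ring
    rw [h6]
    exact div_nonneg (by linarith) (by positivity)
  have h7 := EReal.coe_le_coe_iff.1 ((hg (-v)).trans hle)
  rw [inner_neg_right] at h7
  have h8 : (f (a + S • v) - f a) / S ≤ inner ℝ g v + r * ‖v‖ ^ 2 * S := by linarith
  rw [div_le_iff₀ hS0] at h8
  linarith

/-- The subgradient inequality of `f - (ρ/2) ‖·‖²`, concave on `D`, at a Clarke subgradient of the
upper-`C²` function `f`. -/
theorem UpperC2On.le_of_mem_clarkeSubdiff {f : V → ℝ} {O D : Set V} (hf : UpperC2On f O)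
    (hO : IsOpen O) (hcont : ContinuousOn f O) (hDO : D ⊆ O) {ρ : ℝ}
    (hfρ : ConvexOn ℝ D (fun x => -f x + ρ / 2 * ‖x‖ ^ 2)) {x x' g : V} (hx : x ∈ D)
    (hx' : x' ∈ D) (hg : g ∈ clarkeSubdiff f x) :
    f x' ≤ f x + inner ℝ g (x' - x) + ρ / 2 * ‖x' - x‖ ^ 2 := by
  obtain ⟨r, hr⟩ := hf.eventually_le_of_mem_clarkeSubdiff hO hcont (hDO hx) hg (x' - x)
  have hlim : Tendsto (fun s : ℝ => f x + inner ℝ g (x' - x) + r * s +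
      ρ / 2 * (1 - s) * ‖x' - x‖ ^ 2) (𝓝[>] 0)
      (𝓝 (f x + inner ℝ g (x' - x) + r * 0 + ρ / 2 * (1 - 0) * ‖x' - x‖ ^ 2)) := by
    refine Tendsto.mono_left (Continuous.tendsto (by fun_prop) _) nhdsWithin_le_nhds
  rw [mul_zero, add_zero, sub_zero, mul_one] at hlim
  refine ge_of_tendsto hlim ?_
  filter_upwards [hr, Ioo_mem_nhdsGT (zero_lt_one (α := ℝ))] with s hs hs01
  -- Concavity transfers the bound at the nearby point `x + s • (x' - x)` to `x'`. After division by
  -- `s` the local constant `r` survives only in `r * s`, which vanishes in the limit.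
  have h1 := hfρ.2 hx hx' (sub_nonneg.2 hs01.2.le) hs01.1.le (by ring)
  have h2 : (1 - s) • x + s • x' = x + s • (x' - x) := by
    rw [sub_smul, one_smul, smul_sub]; abel
  simp only [h2, smul_eq_mul] at h1
  have h3 : ‖x + s • (x' - x)‖ ^ 2 = ‖x‖ ^ 2 + 2 * (s * inner ℝ x (x' - x)) +
      s ^ 2 * ‖x' - x‖ ^ 2 := by
    rw [norm_add_sq_real, norm_smul, mul_pow, inner_smul_right, Real.norm_eq_abs, sq_abs]
  have h4 : ‖x'‖ ^ 2 = ‖x‖ ^ 2 + 2 * inner ℝ x (x' - x) + ‖x' - x‖ ^ 2 := by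
    rw [← norm_add_sq_real]; simp
  rw [h3, h4] at h1
  have h5 : s * f x' ≤ s * (f x + inner ℝ g (x' - x) + r * s +
      ρ / 2 * (1 - s) * ‖x' - x‖ ^ 2) := by
    linarith
  exact le_of_mul_le_mul_left h5 hs01.1

/-- Clarke subgradients of a Lipschitz function are bounded by its Lipschitz constant. -/
theorem norm_le_of_mem_clarkeSubdiff {f : V → ℝ} {O : Set V} (hO : IsOpen O) {K : NNReal}
    (hK : LipschitzOnWith K f O) {x g : V} (hx : x ∈ O) (hg : g ∈ clarkeSubdiff f x) :
    ‖g‖ ≤ K := by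
  have hz : Tendsto (fun q : V × ℝ => q.1 + q.2 • g) (𝓝 x ×ˢ 𝓝[>] (0 : ℝ)) (𝓝 x) := by
    have : Tendsto (fun q : V × ℝ => q.1 + q.2 • g) (𝓝 (x, (0 : ℝ))) (𝓝 (x + (0 : ℝ) • g)) := by
      apply Continuous.tendsto (f := fun q : V × ℝ => q.1 + q.2 • g); fun_prop
    rw [nhds_prod_eq] at this
    simpa using this.mono_left (prod_mono le_rfl nhdsWithin_le_nhds)
  have hs : ∀ᶠ q in 𝓝 x ×ˢ 𝓝[>] (0 : ℝ), 0 < q.2 :=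
    (tendsto_snd (f := 𝓝 x)).eventually self_mem_nhdsWithin
  have hle : limsup (fun q : V × ℝ => (((f (q.1 + q.2 • g) - f q.1) / q.2 : ℝ) : EReal))
      (𝓝 x ×ˢ 𝓝[>] (0 : ℝ)) ≤ ((K * ‖g‖ : ℝ) : EReal) := by
    refine limsup_le_of_le (by isBoundedDefault) ?_
    filter_upwards [hz.eventually (hO.mem_nhds hx), hs,
      (tendsto_fst (g := 𝓝[>] (0 : ℝ))).eventually (hO.mem_nhds hx)] with q h1 h2 h3
    rw [EReal.coe_le_coe_iff, div_le_iff₀ h2]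
    have h4 := hK.dist_le_mul _ h1 _ h3
    rw [Real.dist_eq, dist_eq_norm, add_sub_cancel_left, norm_smul, Real.norm_eq_abs,
      abs_of_pos h2] at h4
    have := le_abs_self (f (q.1 + q.2 • g) - f q.1)
    linarith
  have h5 := EReal.coe_le_coe_iff.1 ((hg g).trans hle)
  rw [real_inner_self_eq_norm_sq] at h5
  by_contra! h
  have h6 : 0 < ‖g‖ := lt_of_le_of_lt K.2 h
  nlinarith

end Variational

/-! ### Constraint violation, multipliers and the merit function -/

section Problem
variable {n : ℕ} {E I : Type*}

theorem contDiff_gradient {h : Vec n → ℝ} (hh : ContDiff ℝ 2 h) : ContDiff ℝ 1 (gradient h) :=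
  (InnerProductSpace.toDual ℝ (Vec n)).symm.toContinuousLinearEquiv.contDiff.comp
    (hh.fderiv_right (m := 1) (by norm_num))

variable [Fintype E] [Fintype I]

theorem violation_nonneg (c : E ⊕ I → Vec n → ℝ) (x : Vec n) : 0 ≤ violation c x :=
  add_nonneg (Finset.sum_nonneg fun _ _ => abs_nonneg _)
    (Finset.sum_nonneg fun _ _ => le_max_left _ _)

/-- Lower bound of a multiplier combination by the violation. -/
theorem neg_sum_mul_le_norm_mul_violation (c : E ⊕ I → Vec n → ℝ) (x : Vec n) (μ : E ⊕ I → ℝ)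
    (hμ : ∀ i : I, 0 ≤ μ (Sum.inr i)) :
    -∑ i, μ i * c i x ≤ ‖μ‖ * violation c x := by
  rw [Fintype.sum_sum_type, violation, mul_add, neg_add, Finset.mul_sum, Finset.mul_sum,
    ← Finset.sum_neg_distrib, ← Finset.sum_neg_distrib]
  refine add_le_add (Finset.sum_le_sum fun i _ => ?_) (Finset.sum_le_sum fun i _ => ?_)
  · refine (neg_le_abs _).trans ?_
    rw [abs_mul]
    exact mul_le_mul_of_nonneg_right (norm_le_pi_norm μ (Sum.inl i)) (abs_nonneg _)
  · rw [← mul_neg]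
    refine (mul_le_mul_of_nonneg_left (le_max_right 0 _) (hμ i)).trans ?_
    exact mul_le_mul_of_nonneg_right ((le_abs_self _).trans (norm_le_pi_norm μ (Sum.inr i)))
      (le_max_left _ _)

/-- Along a step to a point satisfying the linearized constraints, the violation decreases
linearly up to a quadratic term. -/
theorem violation_add_smul_le {c : E ⊕ I → Vec n → ℝ} {D : Set (Vec n)} {H : ℝ}
    (hcH : ∀ i, ∀ x ∈ D, ∀ x' ∈ D,
      |c i x' - c i x - inner ℝ (gradient (c i) x) (x' - x)| ≤ H / 2 * ‖x - x'‖ ^ 2)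
    {x d : Vec n} (hlin : (x + d, x) ∈ linFeasible c) {s : ℝ} (hs0 : 0 ≤ s) (hs1 : s ≤ 1)
    (hx : x ∈ D) (hxs : x + s • d ∈ D) :
    violation c (x + s • d) ≤ (1 - s) * violation c x +
      s ^ 2 * (((Fintype.card E + Fintype.card I : ℕ) : ℝ) * H / 2 * ‖d‖ ^ 2) := by
  have hb : ∀ i, |c i (x + s • d) - c i x - s * inner ℝ (gradient (c i) x) d| ≤
      H / 2 * (s ^ 2 * ‖d‖ ^ 2) := by
    intro i
    have := hcH i x hx _ hxs
    simpa [inner_smul_right, norm_smul, mul_pow] using this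
  have hE : ∀ i : E, |c (Sum.inl i) (x + s • d)| ≤
      (1 - s) * |c (Sum.inl i) x| + H / 2 * (s ^ 2 * ‖d‖ ^ 2) := by
    intro i
    have h1 := hlin.1 i
    simp only [linCon, add_sub_cancel_left] at h1
    have h2 := hb (Sum.inl i)
    rw [show inner ℝ (gradient (c (Sum.inl i)) x) d = -c (Sum.inl i) x by linarith] at h2
    have h3 : c (Sum.inl i) (x + s • d) = (1 - s) * c (Sum.inl i) x +
      (c (Sum.inl i) (x + s • d) - c (Sum.inl i) x - s * -c (Sum.inl i) x) := by ring
    rw [h3]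
    refine (abs_add_le _ _).trans (add_le_add ?_ h2)
    rw [abs_mul, abs_of_nonneg (sub_nonneg.2 hs1)]
  have hI : ∀ i : I, max 0 (-c (Sum.inr i) (x + s • d)) ≤
      (1 - s) * max 0 (-c (Sum.inr i) x) + H / 2 * (s ^ 2 * ‖d‖ ^ 2) := by
    intro i
    have h1 := hlin.2 i
    simp only [linCon, add_sub_cancel_left] at h1
    have h2 := hb (Sum.inr i)
    have h4 := mul_le_mul_of_nonneg_left (le_max_right 0 (-c (Sum.inr i) x)) (sub_nonneg.2 hs1)
    have h5 := mul_nonneg (sub_nonneg.2 hs1) (le_max_left 0 (-c (Sum.inr i) x))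
    refine max_le (add_nonneg h5 ((abs_nonneg _).trans h2)) ?_
    have h6 := (abs_le.1 h2).1
    have h7 := mul_nonneg hs0 h1
    linarith
  have h := add_le_add (Finset.sum_le_sum fun i (_ : i ∈ Finset.univ) => hE i)
    (Finset.sum_le_sum fun i (_ : i ∈ Finset.univ) => hI i)
  simp only [Finset.sum_add_distrib, Finset.sum_const, Finset.card_univ, nsmul_eq_mul,
    ← Finset.mul_sum] at h
  unfold violation
  push_cast
  linarith

/-! ### Multipliers -/

theorem IsQPMultiplier.inner_eq {c : E ⊕ I → Vec n → ℝ} {x g : Vec n} {B : Vec n →L[ℝ] Vec n}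
    {θ : ℝ} {d : Vec n} {v w : E → ℝ} {t : I → ℝ} {μ : E ⊕ I → ℝ}
    (h : IsQPMultiplier c x g B θ d v w t μ) (z : Vec n) :
    inner ℝ (g + B d) z = ∑ i, μ i * inner ℝ (gradient (c i) x) z := by
  rw [sub_eq_zero.1 h.1, sum_inner]
  exact Finset.sum_congr rfl fun i _ => by rw [inner_smul_left]; simp

/-- By complementarity the slacks contribute `-θ (v i + w i)` and `-μ i * t i`, all nonpositive.
Exactness of the subproblem is not assumed, so the bound is available before the penalties are known
to converge. -/
theorem IsQPMultiplier.sum_mul_le {c : E ⊕ I → Vec n → ℝ} {x g : Vec n} {B : Vec n →L[ℝ] Vec n}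
    {θ : ℝ} {d : Vec n} {v w : E → ℝ} {t : I → ℝ} {μ : E ⊕ I → ℝ}
    (h : IsQPMultiplier c x g B θ d v w t μ) (hf : QPFeasible c x d v w t) (hθ : 0 ≤ θ) :
    ∑ i, μ i * c i x ≤ -inner ℝ (g + B d) d := by
  rw [h.inner_eq, ← Finset.sum_neg_distrib]
  obtain ⟨-, hcomp, hμ, p, q, r, hp, hq, hr, hpv, hqw, -, hp0, hq0, hr0⟩ := h
  obtain ⟨hfE, -, hv, hw, ht⟩ := hf
  refine Finset.sum_le_sum fun i _ => ?_
  rcases i with i | i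
  · have h1 : μ (Sum.inl i) * (v i - w i) = -(θ * v i) - θ * w i := by
      have h2 : μ (Sum.inl i) * v i = -(θ * v i) := by linear_combination (hp i) * v i + hpv i
      have h3 : μ (Sum.inl i) * w i = θ * w i := by linear_combination -(hq i) * w i - hqw i
      rw [mul_sub, h2, h3]
    rw [← hfE i] at h1
    have := mul_nonneg hθ (hv i)
    have := mul_nonneg hθ (hw i)
    linarith
  · have := hcomp i
    have := mul_nonneg (hμ i) (ht i)
    linarith

/-- If the multiplier does not attain the penalty parameter, all slacks vanish. -/
theorem IsQPMultiplier.slack_eq_zero {c : E ⊕ I → Vec n → ℝ} {x g : Vec n}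
    {B : Vec n →L[ℝ] Vec n} {θ : ℝ} {d : Vec n} {v w : E → ℝ} {t : I → ℝ} {μ : E ⊕ I → ℝ}
    (h : IsQPMultiplier c x g B θ d v w t μ) (hμθ : ‖μ‖ < θ) : v = 0 ∧ w = 0 ∧ t = 0 := by
  obtain ⟨-, -, -, p, q, r, hp, hq, hr, hpv, hqw, hrt, -, -, -⟩ := h
  have hlt : ∀ i, |μ i| < θ := fun i => (norm_le_pi_norm μ i).trans_lt hμθ
  refine ⟨funext fun i => ?_, funext fun i => ?_, funext fun i => ?_⟩
  · refine (mul_eq_zero.1 (hpv i)).resolve_left fun h0 => ?_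
    have := (abs_lt.1 (hlt (Sum.inl i))).1
    linarith [hp i]
  · refine (mul_eq_zero.1 (hqw i)).resolve_left fun h0 => ?_
    have := (abs_lt.1 (hlt (Sum.inl i))).2
    linarith [hq i]
  · refine (mul_eq_zero.1 (hrt i)).resolve_left fun h0 => ?_
    have := (abs_lt.1 (hlt (Sum.inr i))).2
    linarith [hr i]

/-- A subproblem solution with multiplier below the penalty parameter satisfies the linearized
constraints. -/
theorem IsQPMultiplier.mem_linFeasible {c : E ⊕ I → Vec n → ℝ} {x g : Vec n}
    {B : Vec n →L[ℝ] Vec n} {θ : ℝ} {d : Vec n} {v w : E → ℝ} {t : I → ℝ} {μ : E ⊕ I → ℝ}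
    (h : IsQPMultiplier c x g B θ d v w t μ) (hf : QPFeasible c x d v w t) (hμθ : ‖μ‖ < θ) :
    (x + d, x) ∈ linFeasible c := by
  obtain ⟨rfl, rfl, rfl⟩ := h.slack_eq_zero hμθ
  refine ⟨fun i => ?_, fun i => ?_⟩
  · have := hf.1 i
    simpa [linCon] using this
  · have := hf.2.1 i
    simpa [linCon] using this

theorem IsQPMultiplier.mul_linCon_eq_zero {c : E ⊕ I → Vec n → ℝ} {x g : Vec n}
    {B : Vec n →L[ℝ] Vec n} {θ : ℝ} {d : Vec n} {v w : E → ℝ} {t : I → ℝ} {μ : E ⊕ I → ℝ}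
    (h : IsQPMultiplier c x g B θ d v w t μ) (hf : QPFeasible c x d v w t) (hμθ : ‖μ‖ < θ)
    (i : E ⊕ I) : μ i * linCon c i (x + d) x = 0 := by
  have hlin := h.mem_linFeasible hf hμθ
  obtain ⟨rfl, rfl, rfl⟩ := h.slack_eq_zero hμθ
  rcases i with i | i
  · rw [hlin.1 i, mul_zero]
  · have := h.2.1 i
    simpa [linCon] using this

/-- Stationarity is paired with `d`, and complementarity replaces each `μ i * ⟪∇c i, d⟫` by `-μ i *
c i x`. The model decrease is thereby expressed through constraint values, which the violation
controls. -/
theorem IsQPMultiplier.inner_step_eq {c : E ⊕ I → Vec n → ℝ} {x g : Vec n}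
    {B : Vec n →L[ℝ] Vec n} {θ : ℝ} {d : Vec n} {v w : E → ℝ} {t : I → ℝ} {μ : E ⊕ I → ℝ}
    (h : IsQPMultiplier c x g B θ d v w t μ) (hf : QPFeasible c x d v w t) (hμθ : ‖μ‖ < θ) :
    inner ℝ g d + inner ℝ d (B d) = -∑ i, μ i * c i x := by
  rw [real_inner_comm (B d) d, ← inner_add_left, h.inner_eq, ← Finset.sum_neg_distrib]
  refine Finset.sum_congr rfl fun i _ => ?_
  have := h.mul_linCon_eq_zero hf hμθ i
  simp only [linCon, add_sub_cancel_left] at this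
  linarith

/-- A vanishing multiplier combination at a point satisfying MFCQ is trivial. -/
theorem MFCQ.multiplier_eq_zero {c : E ⊕ I → Vec n → ℝ} {x : Vec n} (h : MFCQ c x)
    {μ : E ⊕ I → ℝ} (hμ : ∀ i : I, 0 ≤ μ (Sum.inr i))
    (hsum : ∑ i, μ i • gradient (c i) x = 0) (hcomp : ∑ i, μ i * c i x ≤ 0) : μ = 0 := by
  obtain ⟨⟨hfE, hfI⟩, hind, w, hwI, hwE⟩ := h
  have hI : ∀ i : I, μ (Sum.inr i) * c (Sum.inr i) x = 0 := by
    rw [Fintype.sum_sum_type] at hcomp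
    simp only [hfE, mul_zero, Finset.sum_const_zero, zero_add] at hcomp
    have h0 : ∀ i : I, 0 ≤ μ (Sum.inr i) * c (Sum.inr i) x := fun i => mul_nonneg (hμ i) (hfI i)
    have := (Finset.sum_eq_zero_iff_of_nonneg fun i _ => h0 i).1
      (hcomp.antisymm (Finset.sum_nonneg fun i _ => h0 i))
    exact fun i => this i (Finset.mem_univ i)
  -- Pairing with the MFCQ direction removes the equality constraints and leaves nonnegative terms
  -- with zero sum. Active inequality multipliers therefore vanish, and linear independence handles
  -- the rest.
  have hw : ∑ i : I, μ (Sum.inr i) * inner ℝ (gradient (c (Sum.inr i)) x) w = 0 := by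
    have := congrArg (fun z => inner ℝ z w) hsum
    simp only [sum_inner, inner_zero_left] at this
    rw [Fintype.sum_sum_type] at this
    simpa only [real_inner_smul_left, hwE, mul_zero, Finset.sum_const_zero, zero_add] using this
  have hterm : ∀ i : I, 0 ≤ μ (Sum.inr i) * inner ℝ (gradient (c (Sum.inr i)) x) w := by
    intro i
    rcases mul_eq_zero.1 (hI i) with h0 | h0
    · simp [h0]
    · exact mul_nonneg (hμ i) (hwI i h0).le
  have hI0 : ∀ i : I, μ (Sum.inr i) = 0 := by
    intro i
    rcases mul_eq_zero.1 (hI i) with h0 | h0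
    · exact h0
    · have := (Finset.sum_eq_zero_iff_of_nonneg fun i _ => hterm i).1 hw i (Finset.mem_univ i)
      exact (mul_eq_zero.1 this).resolve_right (hwI i h0).ne'
  rw [Fintype.sum_sum_type] at hsum
  simp only [hI0, zero_smul, Finset.sum_const_zero, add_zero] at hsum
  have hE0 := Fintype.linearIndependent_iff.1 hind _ hsum
  funext i
  rcases i with i | i
  · exact hE0 i
  · exact hI0 i

/-- Under MFCQ at all accumulation points, multipliers of bounded gradients are bounded. -/
theorem eventually_norm_multiplier_le {c : E ⊕ I → Vec n → ℝ} (hc : ∀ i, ContDiff ℝ 2 (c i))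
    {D : Set (Vec n)} (hD : IsCompact D) {x : ℕ → Vec n} (hx : ∀ k, x k ∈ D)
    (hMFCQ : ∀ xbar, MapClusterPt xbar atTop x → MFCQ c xbar)
    {μ : ℕ → E ⊕ I → ℝ} (hμ : ∀ k, ∀ i : I, 0 ≤ μ k (Sum.inr i)) {M : ℝ}
    (hsum : ∀ k, ‖∑ i, μ k i • gradient (c i) (x k)‖ ≤ M)
    (hcomp : ∀ k, ∑ i, μ k i * c i (x k) ≤ M) :
    ∃ Λ, ∀ᶠ k in atTop, ‖μ k‖ ≤ Λ := by
  by_contra! hcon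
  obtain ⟨φ, hφ, hφN⟩ := extraction_forall_of_frequently (P := fun N k => (N : ℝ) < ‖μ k‖)
    fun N => by simpa using hcon N
  -- Along a subsequence of exploding multipliers, normalization sends both bounds `M` to zero. A
  -- limit of `ν` has norm one yet satisfies the hypotheses of `MFCQ.multiplier_eq_zero`, a
  -- contradiction.
  set ν : ℕ → E ⊕ I → ℝ := fun j => ‖μ (φ j)‖⁻¹ • μ (φ j) with hν
  have hpos : ∀ j, 0 < ‖μ (φ j)‖ := fun j => (Nat.cast_nonneg j).trans_lt (hφN j)
  have hνmem : ∀ j, ν j ∈ Metric.sphere (0 : E ⊕ I → ℝ) 1 := fun j => by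
    simp [hν, norm_smul, (hpos j).ne']
  obtain ⟨⟨xh, νh⟩, hmem, ψ, hψ, hlim⟩ := (hD.prod (isCompact_sphere 0 1)).tendsto_subseq
    (x := fun j => (x (φ j), ν j)) fun j => ⟨hx _, hνmem j⟩
  rw [nhds_prod_eq, tendsto_prod_iff'] at hlim
  obtain ⟨hxlim, hνlim⟩ := hlim
  simp only [Function.comp_def] at hxlim hνlim
  have hMF : MFCQ c xh := hMFCQ xh <|
    MapClusterPt.of_comp (hφ.tendsto_atTop.comp hψ.tendsto_atTop) hxlim.mapClusterPt
  have hinv : Tendsto (fun j => ‖μ (φ (ψ j))‖⁻¹) atTop (𝓝 0) := by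
    refine tendsto_inv_atTop_zero.comp (tendsto_atTop_mono (fun j => ?_)
      (tendsto_natCast_atTop_atTop.comp hψ.tendsto_atTop))
    exact (hφN (ψ j)).le
  have hνi : ∀ i, Tendsto (fun j => ν (ψ j) i) atTop (𝓝 (νh i)) := fun i =>
    ((continuous_apply i).tendsto _).comp hνlim
  have hzero : νh = 0 := by
    refine hMF.multiplier_eq_zero (fun i => ?_) ?_ ?_
    · refine ge_of_tendsto' (hνi _) fun j => ?_
      exact mul_nonneg (inv_nonneg.2 (norm_nonneg _)) (hμ _ i)
    · have h1 : Tendsto (fun j => ∑ i, ν (ψ j) i • gradient (c i) (x (φ (ψ j)))) atTop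
          (𝓝 (∑ i, νh i • gradient (c i) xh)) :=
        tendsto_finsetSum _ fun i _ => (hνi i).smul
          (((contDiff_gradient (hc i)).continuous.tendsto _).comp hxlim)
      refine tendsto_nhds_unique h1 (squeeze_zero_norm (fun j => ?_)
        (by simpa using hinv.mul_const M))
      have : ∑ i, ν (ψ j) i • gradient (c i) (x (φ (ψ j))) =
          ‖μ (φ (ψ j))‖⁻¹ • ∑ i, μ (φ (ψ j)) i • gradient (c i) (x (φ (ψ j))) := by
        simp [hν, Finset.smul_sum, smul_smul]
      rw [this, norm_smul, norm_inv, norm_norm]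
      exact mul_le_mul_of_nonneg_left (hsum _) (inv_nonneg.2 (norm_nonneg _))
    · have h1 : Tendsto (fun j => ∑ i, ν (ψ j) i * c i (x (φ (ψ j)))) atTop
          (𝓝 (∑ i, νh i * c i xh)) :=
        tendsto_finsetSum _ fun i _ => (hνi i).mul (((hc i).continuous.tendsto _).comp hxlim)
      refine le_of_tendsto_of_tendsto' h1 (by simpa using hinv.mul_const M) fun j => ?_
      have : ∑ i, ν (ψ j) i * c i (x (φ (ψ j))) =
          ‖μ (φ (ψ j))‖⁻¹ * ∑ i, μ (φ (ψ j)) i * c i (x (φ (ψ j))) := by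
        rw [Finset.mul_sum]
        exact Finset.sum_congr rfl fun i _ => by simp [hν, mul_assoc]
      rw [this]
      exact mul_le_mul_of_nonneg_left (hcomp _) (inv_nonneg.2 (norm_nonneg _))
  have := hmem.2
  simp [hzero] at this

/-- Decrease of the merit function along a step satisfying the linearized constraints. -/
theorem merit_sub_merit_ge {f : Vec n → ℝ} {c : E ⊕ I → Vec n → ℝ} {D : Set (Vec n)} {H ρ : ℝ}
    (hcH : ∀ i, ∀ x ∈ D, ∀ x' ∈ D,
      |c i x' - c i x - inner ℝ (gradient (c i) x) (x' - x)| ≤ H / 2 * ‖x - x'‖ ^ 2)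
    {x g d : Vec n} (hfg : ∀ x' ∈ D, f x' ≤ f x + inner ℝ g (x' - x) + ρ / 2 * ‖x' - x‖ ^ 2)
    (hlin : (x + d, x) ∈ linFeasible c) {s : ℝ} (hs0 : 0 ≤ s) (hs1 : s ≤ 1) (hx : x ∈ D)
    (hxs : x + s • d ∈ D) {Θ : ℝ} (hΘ : 0 ≤ Θ) :
    s * (Θ * violation c x - inner ℝ g d) -
      s ^ 2 / 2 * (ρ + Θ * (((Fintype.card E + Fintype.card I : ℕ) : ℝ) * H)) * ‖d‖ ^ 2 ≤
      merit f c x Θ - merit f c (x + s • d) Θ := by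
  have h1 := mul_le_mul_of_nonneg_left (violation_add_smul_le hcH hlin hs0 hs1 hx hxs) hΘ
  have h2 := hfg _ hxs
  rw [add_sub_cancel_left, inner_smul_right, norm_smul, mul_pow, Real.norm_eq_abs, sq_abs] at h2
  unfold merit
  linarith

/-- The predicted decrease of the merit function dominates the curvature term. -/
theorem IsQPMultiplier.predicted_decrease_ge {c : E ⊕ I → Vec n → ℝ} {x g : Vec n}
    {B : Vec n →L[ℝ] Vec n} {θ : ℝ} {d : Vec n} {v w : E → ℝ} {t : I → ℝ} {μ : E ⊕ I → ℝ}
    (h : IsQPMultiplier c x g B θ d v w t μ) (hf : QPFeasible c x d v w t) (hμθ : ‖μ‖ < θ)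
    (Θ : ℝ) :
    (Θ - ‖μ‖) * violation c x ≤ Θ * violation c x - inner ℝ g d - inner ℝ d (B d) := by
  have h3 := neg_sum_mul_le_norm_mul_violation c x μ h.2.2.1
  rw [← h.inner_step_eq hf hμθ] at h3
  linarith

end Problem

/-! ### Regular subgradients of the potential function -/

section Variational
variable {V : Type*} [NormedAddCommGroup V] [InnerProductSpace ℝ V]

/-- The gradient of a differentiable minorant touching at `u` is a regular subgradient at `u`. -/
theorem mem_regularSubdiff_of_hasFDerivAt {h : V → EReal} {R : V → ℝ} {u s : V}
    (hu : h u = R u) (hle : ∀ z, (R z : EReal) ≤ h z) (hR : HasFDerivAt R (innerSL ℝ s) u) :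
    s ∈ regularSubdiff h u := by
  refine ⟨by rw [hu]; exact EReal.coe_ne_top _, by rw [hu]; exact EReal.coe_ne_bot _,
    fun ε hε => ?_⟩
  filter_upwards [hR.isLittleO.bound hε] with z hz
  refine le_trans ?_ (hle z)
  rw [hu, ← EReal.coe_add, EReal.coe_le_coe_iff]
  have := (abs_le.1 hz).1
  simp only [innerSL_apply_apply] at this
  linarith

theorem mem_generalSubdiff_of_mem_regularSubdiff {h : V → EReal} {u s : V}
    (hs : s ∈ regularSubdiff h u) : s ∈ generalSubdiff h u :=
  ⟨hs.1, hs.2.1, fun _ => u, fun _ => s, tendsto_const_nhds, tendsto_const_nhds, fun _ => hs,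
    tendsto_const_nhds⟩

end Variational

section Problem
variable {n : ℕ} {E I : Type*}

theorem le_conjugate_convexPart {f : Vec n → ℝ} {D : Set (Vec n)} {σ : ℝ} {x : Vec n} (hx : x ∈ D)
    (y : Vec n) :
    ((inner ℝ y x - (-f x + σ / 2 * ‖x‖ ^ 2) : ℝ) : EReal) ≤ conjugate (convexPart f D σ) y := by
  refine le_trans (le_of_eq ?_) (le_iSup _ x)
  rw [convexPart, if_pos hx, ← EReal.coe_sub]

/-- The conjugate at a subgradient: equality in the Fenchel-Young inequality. -/
theorem conjugate_convexPart_eq {f : Vec n → ℝ} {D : Set (Vec n)} {σ : ℝ} {x y : Vec n}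
    (hx : x ∈ D)
    (hopt : ∀ x' ∈ D, inner ℝ y x' - (-f x' + σ / 2 * ‖x'‖ ^ 2) ≤
      inner ℝ y x - (-f x + σ / 2 * ‖x‖ ^ 2)) :
    conjugate (convexPart f D σ) y = ((inner ℝ y x - (-f x + σ / 2 * ‖x‖ ^ 2) : ℝ) : EReal) := by
  refine le_antisymm (iSup_le fun x' => ?_) (le_conjugate_convexPart hx y)
  by_cases hx' : x' ∈ D
  · rw [convexPart, if_pos hx', ← EReal.coe_sub, EReal.coe_le_coe_iff]
    exact hopt x' hx'
  · rw [convexPart, if_neg hx', EReal.sub_top]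
    exact bot_le

/-- The space of triples `(x, y, w)` on which the potential function lives. -/
abbrev Triple (n : ℕ) : Type := PiLp 2 (fun _ : Fin 3 => Vec n)

/-- The triple `(x, y, w)`. -/
abbrev triple (x y w : Vec n) : Triple n := WithLp.toLp 2 ![x, y, w]

theorem norm_triple_le (x y w : Vec n) : ‖triple x y w‖ ≤ ‖x‖ + ‖y‖ + ‖w‖ := by
  rw [PiLp.norm_eq_of_L2, Fin.sum_univ_three]
  refine Real.sqrt_le_iff.2 ⟨by positivity, ?_⟩
  simp only [Matrix.cons_val_zero, Matrix.cons_val_one, Matrix.cons_val]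
  nlinarith [mul_nonneg (norm_nonneg x) (norm_nonneg y), mul_nonneg (norm_nonneg x) (norm_nonneg w),
    mul_nonneg (norm_nonneg y) (norm_nonneg w)]

theorem inner_triple (x y w : Vec n) (z : Triple n) :
    inner ℝ (triple x y w) z = inner ℝ x (z 0) + inner ℝ y (z 1) + inner ℝ w (z 2) := by
  rw [PiLp.inner_apply, Fin.sum_univ_three]
  rfl

theorem continuous_triple : Continuous fun q : Vec n × Vec n × Vec n => triple q.1 q.2.1 q.2.2 := by
  refine (PiLp.continuous_toLp 2 _).comp (continuous_pi fun i => ?_)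
  fin_cases i <;> simp <;> fun_prop

theorem potential_eq {f : Vec n → ℝ} {c : E ⊕ I → Vec n → ℝ} {D : Set (Vec n)} {σ l : ℝ}
    {x x₀ y w : Vec n} (hx₀ : x₀ ∈ D)
    (hopt : ∀ x' ∈ D, inner ℝ y x' - (-f x' + σ / 2 * ‖x'‖ ^ 2) ≤
      inner ℝ y x₀ - (-f x₀ + σ / 2 * ‖x₀‖ ^ 2))
    (hlin : (x, w) ∈ linFeasible c) :
    potential f c D σ l (triple x y w) =
      ((-inner ℝ y x + (inner ℝ y x₀ - (-f x₀ + σ / 2 * ‖x₀‖ ^ 2)) + σ / 2 * ‖x‖ ^ 2 +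
        l / 2 * ‖x - w‖ ^ 2 : ℝ) : EReal) := by
  have hlin' : ((triple x y w) 0, (triple x y w) 2) ∈ linFeasible c := hlin
  rw [potential, indicatorFn, if_pos hlin', add_zero]
  simp only [Matrix.cons_val_zero, Matrix.cons_val_one, Matrix.cons_val]
  rw [conjugate_convexPart_eq hx₀ hopt]
  norm_cast

/-- In the `w` variable the derivative of `c i w` cancels that of `-w` inside the inner product.
Only the second derivative applied to `x - w` remains, so this component is of the order of the
step. -/
theorem hasFDerivAt_linCon {c : E ⊕ I → Vec n → ℝ} (hc : ∀ i, ContDiff ℝ 2 (c i)) (i : E ⊕ I)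
    (u : Triple n) :
    HasFDerivAt (fun z : Triple n => linCon c i (z 0) (z 2))
      (innerSL ℝ (triple (gradient (c i) (u 2)) 0
        (ContinuousLinearMap.adjoint (fderiv ℝ (gradient (c i)) (u 2)) (u 0 - u 2)))) u := by
  have hp : ∀ j : Fin 3, HasFDerivAt (fun z : Triple n => z j)
      (PiLp.proj 2 (fun _ : Fin 3 => Vec n) j : Triple n →L[ℝ] Vec n) u := fun j =>
    (PiLp.proj 2 (fun _ : Fin 3 => Vec n) j : Triple n →L[ℝ] Vec n).hasFDerivAt
  have hg := (((contDiff_gradient (hc i)).differentiable (by norm_num)) (u 2)).hasFDerivAt.comp u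
    (hp 2)
  have hcd := (((hc i).differentiable (by norm_num)) (u 2)).hasFDerivAt.comp u (hp 2)
  have h := hcd.add (hg.inner ℝ ((hp 0).sub (hp 2)))
  refine h.congr_fderiv ?_
  ext z
  rw [innerSL_apply_apply, inner_triple, ContinuousLinearMap.adjoint_inner_left,
    real_inner_comm]
  simp [fderivInnerCLM_apply, inner_sub_right, inner_sub_left]
  rw [real_inner_comm (u 0), real_inner_comm (u 2)]
  ring

variable [Fintype E] [Fintype I]

/-- The smooth minorant of the potential function obtained from a point `x₀` of `D` and
multipliers `μ`. -/
def potentialMinorant (f : Vec n → ℝ) (c : E ⊕ I → Vec n → ℝ) (σ l : ℝ) (x₀ : Vec n)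
    (μ : E ⊕ I → ℝ) (u : Triple n) : ℝ :=
  -inner ℝ (u 1) (u 0) + (inner ℝ (u 1) x₀ - (-f x₀ + σ / 2 * ‖x₀‖ ^ 2)) + σ / 2 * ‖u 0‖ ^ 2 +
    l / 2 * ‖u 0 - u 2‖ ^ 2 - ∑ i, μ i * linCon c i (u 0) (u 2)

/-- The conjugate is bounded below by its term at `x₀`, and the indicator by the negated Lagrangian
term, which is nonpositive on `linFeasible c`. Off that set the potential is `⊤`, because its other
summands never reach `⊥`. -/
theorem potentialMinorant_le {f : Vec n → ℝ} {c : E ⊕ I → Vec n → ℝ} {D : Set (Vec n)} {σ l : ℝ}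
    {x₀ : Vec n} (hx₀ : x₀ ∈ D) {μ : E ⊕ I → ℝ} (hμ : ∀ i : I, 0 ≤ μ (Sum.inr i)) (u : Triple n) :
    (potentialMinorant f c σ l x₀ μ u : EReal) ≤ potential f c D σ l u := by
  have hconj := le_conjugate_convexPart (f := f) (σ := σ) hx₀ (u 1)
  have hle : ((-inner ℝ (u 1) (u 0) + (inner ℝ (u 1) x₀ - (-f x₀ + σ / 2 * ‖x₀‖ ^ 2)) +
      σ / 2 * ‖u 0‖ ^ 2 + l / 2 * ‖u 0 - u 2‖ ^ 2 : ℝ) : EReal) ≤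
      ((-inner ℝ (u 1) (u 0) : ℝ) : EReal) + conjugate (convexPart f D σ) (u 1)
        + ((σ / 2 * ‖u 0‖ ^ 2 : ℝ) : EReal) + ((l / 2 * ‖u 0 - u 2‖ ^ 2 : ℝ) : EReal) := by
    rw [EReal.coe_add, EReal.coe_add, EReal.coe_add]
    gcongr
  by_cases hlin : (u 0, u 2) ∈ linFeasible c
  · rw [potential, indicatorFn, if_pos hlin, add_zero]
    refine le_trans (EReal.coe_le_coe_iff.2 (sub_le_self _ (Finset.sum_nonneg fun i _ => ?_))) hle
    rcases i with i | i
    · rw [hlin.1 i, mul_zero]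
    · exact mul_nonneg (hμ i) (hlin.2 i)
  · rw [potential, indicatorFn, if_neg hlin, EReal.add_top_of_ne_bot]
    · exact le_top
    · exact ((EReal.bot_lt_coe _).trans_le hle).ne'

theorem hasFDerivAt_potentialMinorant {f : Vec n → ℝ} {c : E ⊕ I → Vec n → ℝ}
    (hc : ∀ i, ContDiff ℝ 2 (c i)) (σ l : ℝ) (x₀ : Vec n) (μ : E ⊕ I → ℝ) (u : Triple n) :
    HasFDerivAt (potentialMinorant f c σ l x₀ μ)
      (innerSL ℝ (triple (-u 1 + σ • u 0 + l • (u 0 - u 2) - ∑ i, μ i • gradient (c i) (u 2))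
        (x₀ - u 0)
        (-(l • (u 0 - u 2)) - ∑ i, μ i •
          ContinuousLinearMap.adjoint (fderiv ℝ (gradient (c i)) (u 2)) (u 0 - u 2)))) u := by
  have hp : ∀ j : Fin 3, HasFDerivAt (fun z : Triple n => z j)
      (PiLp.proj 2 (fun _ : Fin 3 => Vec n) j : Triple n →L[ℝ] Vec n) u := fun j =>
    (PiLp.proj 2 (fun _ : Fin 3 => Vec n) j : Triple n →L[ℝ] Vec n).hasFDerivAt
  have hsum := HasFDerivAt.fun_sum (u := Finset.univ) fun i _ =>
    (hasFDerivAt_linCon hc i u).const_mul (μ i)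
  have h := (((((hp 1).inner ℝ (hp 0)).neg.add
    (((hp 1).inner ℝ (hasFDerivAt_const x₀ u)).sub_const (-f x₀ + σ / 2 * ‖x₀‖ ^ 2))).add
    ((hp 0).norm_sq.const_mul (σ / 2))).add
    (((hp 0).sub (hp 2)).norm_sq.const_mul (l / 2))).sub hsum
  refine h.congr_fderiv ?_
  ext z
  rw [innerSL_apply_apply, inner_triple]
  simp only [inner_sub_left, inner_add_left, real_inner_smul_left, inner_neg_left, sum_inner]
  simp [-Fintype.sum_sum_type, fderivInnerCLM_apply, inner_triple, inner_sub_left]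
  simp only [mul_add, Finset.sum_add_distrib]
  rw [real_inner_comm (u 0) (z 1), real_inner_comm x₀ (z 1)]
  ring

/-- A regular subgradient of the potential function. -/
theorem mem_regularSubdiff_potential {f : Vec n → ℝ} {c : E ⊕ I → Vec n → ℝ}
    (hc : ∀ i, ContDiff ℝ 2 (c i)) {D : Set (Vec n)} {σ l : ℝ} {x x₀ y w : Vec n} (hx₀ : x₀ ∈ D)
    (hopt : ∀ x' ∈ D, inner ℝ y x' - (-f x' + σ / 2 * ‖x'‖ ^ 2) ≤
      inner ℝ y x₀ - (-f x₀ + σ / 2 * ‖x₀‖ ^ 2))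
    (hlin : (x, w) ∈ linFeasible c) {μ : E ⊕ I → ℝ} (hμ : ∀ i : I, 0 ≤ μ (Sum.inr i))
    (hcomp : ∀ i, μ i * linCon c i x w = 0) :
    triple (-y + σ • x + l • (x - w) - ∑ i, μ i • gradient (c i) w) (x₀ - x)
        (-(l • (x - w)) - ∑ i, μ i •
          ContinuousLinearMap.adjoint (fderiv ℝ (gradient (c i)) w) (x - w)) ∈
      regularSubdiff (potential f c D σ l) (triple x y w) := by
  refine mem_regularSubdiff_of_hasFDerivAt (R := potentialMinorant f c σ l x₀ μ) ?_
    (potentialMinorant_le hx₀ hμ) (hasFDerivAt_potentialMinorant hc σ l x₀ μ (triple x y w))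
  rw [potential_eq hx₀ hopt hlin]
  simp [potentialMinorant, hcomp]

end Problem

/-! ### From a linear error bound to R-linear convergence -/

/-- Sufficient decrease together with a linear error bound on the decrease gives R-linear
convergence. -/
theorem exists_tendsto_of_linear_decrease {V : Type*} [NormedAddCommGroup V]
    [CompleteSpace V] {x : ℕ → V} {Φ : ℕ → ℝ}
    {Φs c C : ℝ} (hc : 0 < c)
    (hdec : ∀ᶠ k in atTop, c * ‖x (k + 1) - x k‖ ^ 2 ≤ Φ k - Φ (k + 1))
    (herr : ∀ᶠ k in atTop, Φ k - Φs ≤ C * (Φ k - Φ (k + 1))) (hΦ : ∀ᶠ k in atTop, Φs ≤ Φ k) :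
    ∃ xbar : V, Tendsto x atTop (𝓝 xbar) ∧ ∃ q₀ q₁ : ℝ, 0 < q₀ ∧ q₀ < 1 ∧ 0 < q₁ ∧
      ∀ᶠ k in atTop, ‖x k - xbar‖ ≤ q₁ * q₀ ^ k := by
  obtain ⟨K, hK⟩ := eventually_atTop.1 (hdec.and (herr.and hΦ))
  -- The floor `2` keeps the contraction factor `1 - 1 / C'` strictly positive.
  set C' := max C 2 with hC'
  have hC2 : 2 ≤ C' := le_max_right _ _
  set r := 1 - 1 / C' with hr
  have hinv : 0 < 1 / C' ∧ 1 / C' ≤ 1 / 2 :=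
    ⟨by positivity, one_div_le_one_div_of_le (by norm_num) hC2⟩
  have hr0 : 0 < r := by linarith [hinv.2]
  have hr1 : r < 1 := by linarith [hinv.1]
  have hstep : ∀ k ≥ K, Φ (k + 1) - Φs ≤ r * (Φ k - Φs) := by
    intro k hk
    obtain ⟨h1, h2, -⟩ := hK k hk
    have h3 : 0 ≤ Φ k - Φ (k + 1) := le_trans (by positivity) h1
    have h4 : Φ k - Φs ≤ C' * (Φ k - Φ (k + 1)) :=
      h2.trans (mul_le_mul_of_nonneg_right (le_max_left _ _) h3)
    have h5 : 1 / C' * (Φ k - Φs) ≤ Φ k - Φ (k + 1) := by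
      rw [one_div, inv_mul_le_iff₀ (by linarith)]
      exact h4
    rw [hr]
    linarith
  set M := Φ K - Φs with hM
  have hgeo : ∀ j, Φ (K + j) - Φs ≤ M * r ^ j := by
    intro j
    induction j with
    | zero => simp [hM]
    | succ j ih =>
      have := (hstep (K + j) (Nat.le_add_right _ _)).trans (mul_le_mul_of_nonneg_left ih hr0.le)
      rw [pow_succ, ← add_assoc]
      linarith
  set q := Real.sqrt r with hq
  have hq0 : 0 < q := Real.sqrt_pos.2 hr0
  have hq1 : q < 1 := by rw [hq, Real.sqrt_lt' one_pos]; linarith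
  set A := Real.sqrt (M / c) with hA
  have hdist : ∀ j, dist (x (K + j)) (x (K + (j + 1))) ≤ A * q ^ j := by
    intro j
    obtain ⟨h1, -, -⟩ := hK (K + j) (Nat.le_add_right _ _)
    obtain ⟨-, -, h3⟩ := hK (K + j + 1) (by omega)
    have hM0 : 0 ≤ M := sub_nonneg.2 (hK K le_rfl).2.2
    rw [dist_comm, dist_eq_norm, ← add_assoc]
    refine abs_le_of_sq_le_sq' ?_ (by positivity) |>.2
    rw [mul_pow, hA, Real.sq_sqrt (by positivity), ← pow_mul, mul_comm j 2, pow_mul, hq,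
      Real.sq_sqrt hr0.le, div_mul_eq_mul_div, le_div_iff₀ hc]
    linarith [hgeo j]
  obtain ⟨xbar, hx⟩ := cauchySeq_tendsto_of_complete (cauchySeq_of_le_geometric q A hq1 hdist)
  have hrate := dist_le_of_le_geometric_of_tendsto q A hq1 hdist hx
  -- Dividing by `q ^ K` undoes the index shift. The summand `1` makes the constant positive even
  -- when `A = 0`.
  refine ⟨xbar, (tendsto_add_atTop_iff_nat K).1 (by simpa only [add_comm] using hx), q,
    A / (1 - q) / q ^ K + 1, hq0, hq1, ?_, ?_⟩
  · have : 0 < 1 - q := by linarith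
    positivity
  · filter_upwards [eventually_ge_atTop K] with k hk
    obtain ⟨j, rfl⟩ := Nat.exists_eq_add_of_le hk
    have h1 := hrate j
    rw [dist_eq_norm] at h1
    have h2 : (A / (1 - q) / q ^ K + 1) * q ^ (K + j) = A * q ^ j / (1 - q) + q ^ (K + j) := by
      have : 1 - q ≠ 0 := by linarith
      rw [pow_add]
      field_simp
    rw [h2]
    have : 0 < q ^ (K + j) := by positivity
    linarith

/-! ### The KL inequality with exponent at most one half -/

section Variational
variable {V : Type*} [NormedAddCommGroup V] [InnerProductSpace ℝ V]

/-- A KL function with exponent at most `1/2` grows at most quadratically in the size of its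
subgradients along a bounded sequence on which its values converge to its value at every
accumulation point. -/
theorem IsKLWithExponent.exists_quadratic_bound {h : V → EReal} {κ : ℝ}
    (hKL : IsKLWithExponent h κ) (hκ0 : 0 < κ) (hκ : κ ≤ 1 / 2) {K : Set V} (hK : IsCompact K)
    {u s : ℕ → V} {e val : ℕ → ℝ} {hs M : ℝ} (huK : ∀ᶠ k in atTop, u k ∈ K)
    (hval : ∀ᶠ k in atTop, h (u k) = val k) (hlim : Tendsto val atTop (𝓝 hs))
    (hsub : ∀ᶠ k in atTop, s k ∈ regularSubdiff h (u k))
    (hse : ∀ᶠ k in atTop, ‖s k‖ ≤ M * e k) (he : Tendsto e atTop (𝓝 0))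
    (hcluster : ∀ uh, ∀ φ : ℕ → ℕ, StrictMono φ → Tendsto (u ∘ φ) atTop (𝓝 uh) → h uh = hs) :
    ∃ C, ∀ᶠ k in atTop, val k - hs ≤ C * e k ^ 2 := by
  by_contra! hcon
  obtain ⟨φ, hφ, hφP⟩ := extraction_forall_of_frequently (P := fun N k =>
      (N : ℝ) * e k ^ 2 < val k - hs ∧ u k ∈ K ∧ h (u k) = val k ∧ s k ∈ regularSubdiff h (u k) ∧
      ‖s k‖ ≤ M * e k) fun N =>
    (hcon N).and_eventually (huK.and (hval.and (hsub.and hse)))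
  obtain ⟨uh, -, ψ, hψ, hulim⟩ := hK.tendsto_subseq fun j => (hφP j).2.1
  have hφψ := hφ.comp hψ
  have huh := hcluster uh (φ ∘ ψ) hφψ hulim
  have hlimsub := hlim.comp hφψ.tendsto_atTop
  have helim := he.comp hφψ.tendsto_atTop
  -- The subgradients tend to zero and the values converge to `h uh`, so the limit lies in the
  -- domain of the limiting subdifferential and the KL property applies there.
  have hzero : (0 : V) ∈ generalSubdiff h uh := by
    refine ⟨by simp [huh], by simp [huh], u ∘ φ ∘ ψ, s ∘ φ ∘ ψ, hulim, ?_,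
      fun j => (hφP (ψ j)).2.2.2.1, ?_⟩
    · rw [huh]
      refine ((continuous_coe_real_ereal.tendsto _).comp hlimsub).congr fun j => ?_
      exact (hφP (ψ j)).2.2.1.symm
    · refine squeeze_zero_norm (fun j => (hφP (ψ j)).2.2.2.2) ?_
      simpa using helim.const_mul M
  obtain ⟨a₀, ha₀, η, hη, -, U, hU, hKLU⟩ := hKL uh ⟨0, hzero⟩
  obtain ⟨ε, hε0, hεη⟩ := EReal.lt_iff_exists_real_btwn.1 hη
  have hε0 : 0 < ε := by exact_mod_cast hε0
  set A := a₀ * (1 - κ) * M with hA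
  obtain ⟨N, hN⟩ := exists_nat_ge (A ^ 2)
  -- The bound `ε` admits the KL inequality; the bound `1` gives `T ^ (1 / 2) ≤ T ^ κ`. Together
  -- they yield `T ≤ A ^ 2 * e k ^ 2`, contradicting `N ≥ A ^ 2`.
  have hsmall : ∀ᶠ j in atTop, val (φ (ψ j)) < hs + min ε 1 :=
    hlimsub.eventually_lt_const (by have := lt_min hε0 one_pos; linarith)
  obtain ⟨j, hjU, hjs, hjN⟩ := ((hulim.eventually hU).and
    (hsmall.and (hψ.tendsto_atTop.eventually (eventually_ge_atTop N)))).exists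
  obtain ⟨h1, -, h3, h4, h5⟩ := hφP (ψ j)
  simp only [Function.comp_apply] at hjU
  set k := φ (ψ j)
  set T := val k - hs with hT
  have hNT : (N : ℝ) * e k ^ 2 < T :=
    lt_of_le_of_lt (mul_le_mul_of_nonneg_right (by exact_mod_cast hjN) (sq_nonneg _)) h1
  have hT0 : 0 < T := lt_of_le_of_lt (by positivity) hNT
  have hTε : T < ε := by have := min_le_left ε 1; linarith
  have hT1 : T < 1 := by have := min_le_right ε 1; linarith
  have h6 := hKLU (u k) hjU (by rw [huh, h3, EReal.coe_lt_coe_iff]; linarith) (by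
    rw [huh, h3]
    refine lt_of_lt_of_le ?_ (add_le_add_right hεη.le _)
    rw [← EReal.coe_add, EReal.coe_lt_coe_iff]
    linarith)
  rw [h3, huh, EReal.toReal_coe, EReal.toReal_coe, ← hT] at h6
  have hder : deriv (fun s : ℝ => a₀ * s ^ (1 - κ)) T = a₀ * ((1 - κ) * T ^ (-κ)) := by
    rw [deriv_const_mul _ (Real.differentiableAt_rpow_const_of_ne _ hT0.ne'),
      Real.deriv_rpow_const]
    ring_nf
  have hdist : Metric.infEDist (0 : V) (generalSubdiff h (u k)) ≤ ENNReal.ofReal (M * e k) := by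
    refine (Metric.infEDist_le_edist_of_mem (mem_generalSubdiff_of_mem_regularSubdiff h4)).trans ?_
    rw [edist_dist, dist_zero_left]
    exact ENNReal.ofReal_le_ofReal h5
  have hTκ : 0 < T ^ κ := Real.rpow_pos_of_pos hT0 _
  have hpos : 0 ≤ a₀ * ((1 - κ) * T ^ (-κ)) := by
    have : 0 ≤ 1 - κ := by linarith
    have := Real.rpow_nonneg hT0.le (-κ)
    positivity
  have h7 := h6.trans (mul_le_mul_right hdist _)
  rw [hder, ← ENNReal.ofReal_mul hpos, ENNReal.one_le_ofReal, Real.rpow_neg hT0.le] at h7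
  have h8 : T ^ κ ≤ A * e k := by
    have := mul_le_mul_of_nonneg_left h7 hTκ.le
    have h9 : T ^ κ * (a₀ * ((1 - κ) * (T ^ κ)⁻¹) * (M * e k)) = A * e k := by
      rw [hA]; field_simp
    linarith
  have h10 : T ^ (1 / 2 : ℝ) ≤ A * e k :=
    (Real.rpow_le_rpow_of_exponent_ge hT0 hT1.le hκ).trans h8
  have h11 : T ≤ (A * e k) ^ 2 := by
    have := pow_le_pow_left₀ (Real.rpow_nonneg hT0.le _) h10 2
    rwa [← Real.sqrt_eq_rpow, Real.sq_sqrt hT0.le] at this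
  have h12 := mul_le_mul_of_nonneg_right hN (sq_nonneg (e k))
  rw [mul_pow] at h11
  linarith

end Variational

/-! ### Penalty parameters and step sizes along a run -/

section Problem
variable {n : ℕ} {E I : Type*} [Fintype E] [Fintype I] {f : Vec n → ℝ} {c : E ⊕ I → Vec n → ℝ}
  {η τ γ : ℝ} {x g d : ℕ → Vec n} {B : ℕ → Vec n →L[ℝ] Vec n} {v w : ℕ → E → ℝ} {t : ℕ → I → ℝ}
  {mult : ℕ → E ⊕ I → ℝ} {θ a : ℕ → ℝ}

theorem IsSQPRun.penalty_monotone (hrun : IsSQPRun f c η τ γ x g d B v w t mult θ a) :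
    Monotone θ :=
  monotone_nat_of_le_succ fun k => by rw [hrun.penalty_update k]; exact le_max_left _ _

theorem IsSQPRun.penalty_pos' (hrun : IsSQPRun f c η τ γ x g d B v w t mult θ a) (k : ℕ) :
    0 < θ k :=
  hrun.penalty_pos.trans_le (hrun.penalty_monotone (Nat.zero_le k))

theorem IsSQPRun.norm_mult_add_le (hrun : IsSQPRun f c η τ γ x g d B v w t mult θ a) (k : ℕ) :
    ‖mult (k + 1)‖ + γ ≤ θ (k + 1) := by
  rw [hrun.penalty_update k]; exact le_max_right _ _

theorem IsSQPRun.stepsize_mem (hrun : IsSQPRun f c η τ γ x g d B v w t mult θ a)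
    (hτ : 0 < τ ∧ τ < 1) (k : ℕ) : 0 < a k ∧ a k ≤ 1 := by
  obtain ⟨j, hj, -, -⟩ := hrun.line_search k
  rw [hj]
  exact ⟨pow_pos hτ.1 j, pow_le_one₀ hτ.1.le hτ.2.le⟩

/-- Under MFCQ at all accumulation points the penalty parameters converge. -/
theorem IsSQPRun.exists_tendsto_penalty (hrun : IsSQPRun f c η τ γ x g d B v w t mult θ a)
    (hc : ∀ i, ContDiff ℝ 2 (c i)) {D : Set (Vec n)} (hD : IsCompact D) (hx : ∀ k, x k ∈ D)
    (hMFCQ : ∀ xbar, MapClusterPt xbar atTop x → MFCQ c xbar) {G β R : ℝ}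
    (hg : ∀ k, ‖g k‖ ≤ G) (hB : ∀ k, ‖B k‖ ≤ β) (hd : ∀ k, ‖d k‖ ≤ R) :
    ∃ Θ, Tendsto θ atTop (𝓝 Θ) := by
  have hG0 : 0 ≤ G := (norm_nonneg _).trans (hg 0)
  have hβ0 : 0 ≤ β := (norm_nonneg _).trans (hB 0)
  have hR0 : 0 ≤ R := (norm_nonneg _).trans (hd 0)
  have hgB : ∀ k, ‖g k + B k (d k)‖ ≤ G + β * R := fun k =>
    (norm_add_le _ _).trans (add_le_add (hg k) (((B k).le_opNorm _).trans
      (mul_le_mul (hB k) (hd k) (norm_nonneg _) hβ0)))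
  have hsum : ∀ k, ‖∑ i, mult (k + 1) i • gradient (c i) (x k)‖ ≤ (G + β * R) * (1 + R) := by
    intro k
    rw [← sub_eq_zero.1 (hrun.qp_multiplier k).1]
    exact (hgB k).trans (le_mul_of_one_le_right (by positivity) (by linarith))
  have hcomp : ∀ k, ∑ i, mult (k + 1) i * c i (x k) ≤ (G + β * R) * (1 + R) := by
    intro k
    refine ((hrun.qp_multiplier k).sum_mul_le (hrun.qp_solution k).1
      (hrun.penalty_pos' k).le).trans ((neg_le_abs _).trans
        ((abs_real_inner_le_norm _ _).trans ?_))
    exact mul_le_mul (hgB k) ((hd k).trans (by linarith)) (norm_nonneg _) (by positivity)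
  obtain ⟨Λ, hΛ⟩ := eventually_norm_multiplier_le hc hD hx hMFCQ
    (fun k => (hrun.qp_multiplier k).2.2.1) hsum hcomp
  obtain ⟨K, hK⟩ := eventually_atTop.1 hΛ
  have hbdd : ∀ j, θ (K + j) ≤ max (θ K) (Λ + γ) := by
    intro j
    induction j with
    | zero => exact le_max_left _ _
    | succ j ih =>
      rw [← add_assoc, hrun.penalty_update]
      refine max_le ih (le_max_of_le_right ?_)
      have := hK (K + j) (Nat.le_add_right _ _)
      linarith
  refine ⟨_, tendsto_atTop_ciSup hrun.penalty_monotone ⟨max (θ K) (Λ + γ), ?_⟩⟩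
  rintro _ ⟨k, rfl⟩
  exact (hrun.penalty_monotone (Nat.le_add_left k K)).trans (hbdd k)

/-- The backtracking line search accepts step sizes bounded away from zero. -/
theorem IsSQPRun.stepsize_ge (hrun : IsSQPRun f c η τ γ x g d B v w t mult θ a)
    (hη : η < 1) (hτ : 0 < τ ∧ τ < 1) {D : Set (Vec n)} (hDconvex : Convex ℝ D) {H ρ : ℝ}
    (hcH : ∀ i, ∀ x ∈ D, ∀ x' ∈ D,
      |c i x' - c i x - inner ℝ (gradient (c i) x) (x' - x)| ≤ H / 2 * ‖x - x'‖ ^ 2)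
    {b r : ℝ} (hr : 0 < r) {k : ℕ}
    (hfg : ∀ x' ∈ D, f x' ≤ f (x k) + inner ℝ (g k) (x' - x k) + ρ / 2 * ‖x' - x k‖ ^ 2)
    (hx : x k ∈ D) (hxd : x k + d k ∈ D) (hBb : b * ‖d k‖ ^ 2 ≤ inner ℝ (d k) (B k (d k)))
    (hmult : ‖mult (k + 1)‖ < θ k)
    (hθ : ρ + θ k * (((Fintype.card E + Fintype.card I : ℕ) : ℝ) * H) ≤ r) :
    min 1 (τ * ((2 - η) * b / r)) ≤ a k := by
  obtain ⟨j, hj, -, hfail⟩ := hrun.line_search k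
  rcases Nat.eq_zero_or_pos j with rfl | hjpos
  · rw [hj, pow_zero]
    exact min_le_left _ _
  obtain ⟨i, rfl⟩ : ∃ i, j = i + 1 := ⟨j - 1, by omega⟩
  refine (min_le_right _ _).trans ?_
  rw [hj, pow_succ']
  refine mul_le_mul_of_nonneg_left ?_ hτ.1.le
  -- The last rejected trial step is `τ ^ i`. Below the threshold `(2 - η) * b / r` the quadratic
  -- error is absorbed by the curvature left over after the Armijo fraction, so it would have been
  -- accepted.
  by_contra! hlt
  refine hfail i (Nat.lt_succ_self i) ?_
  set s := τ ^ i with hs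
  have hs0 : 0 < s := pow_pos hτ.1 i
  have hs1 : s ≤ 1 := pow_le_one₀ hτ.1.le hτ.2.le
  have hqp := hrun.qp_multiplier k
  have hfeas := (hrun.qp_solution k).1
  have hxs : x k + s • d k ∈ D := hDconvex.add_smul_mem hx hxd ⟨hs0.le, hs1⟩
  have h1 := merit_sub_merit_ge hcH hfg (hqp.mem_linFeasible hfeas hmult) hs0.le hs1 hx hxs
    (hrun.penalty_pos' k).le
  have h2 := hqp.predicted_decrease_ge hfeas hmult (θ k)
  have h3 : 0 ≤ (θ k - ‖mult (k + 1)‖) * violation c (x k) :=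
    mul_nonneg (sub_nonneg.2 hmult.le) (violation_nonneg _ _)
  have h4 : inner ℝ (d k) (B k (d k)) ≤ θ k * violation c (x k) - inner ℝ (g k) (d k) := by
    linarith
  have h5 := mul_le_mul_of_nonneg_left h4 hs0.le
  have h6 := mul_le_mul_of_nonneg_left hθ (show 0 ≤ s ^ 2 / 2 * ‖d k‖ ^ 2 by positivity)
  rw [lt_div_iff₀ hr] at hlt
  have h7 := mul_le_mul_of_nonneg_left hlt.le (show 0 ≤ s / 2 * ‖d k‖ ^ 2 by positivity)
  have h8 := mul_le_mul_of_nonneg_left hBb (show 0 ≤ s / 2 * (2 - η) by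
    have : 0 ≤ 2 - η := by linarith
    positivity)
  unfold LineSearchCond
  linarith

/-- Boundedness of the second derivatives of the constraints on a compact set. -/
theorem exists_norm_adjoint_fderiv_gradient_le (hc : ∀ i, ContDiff ℝ 2 (c i)) {D : Set (Vec n)}
    (hD : IsCompact D) (Θ : ℝ) :
    ∃ A, ∀ x ∈ D, ∀ (d : Vec n) (μ : E ⊕ I → ℝ), ‖μ‖ ≤ Θ →
      ‖∑ i, μ i • ContinuousLinearMap.adjoint (fderiv ℝ (gradient (c i)) x) d‖ ≤ A * ‖d‖ := by
  have h : ∀ i, ∃ A, ∀ x ∈ D, ‖fderiv ℝ (gradient (c i)) x‖ ≤ A := fun i =>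
    hD.exists_bound_of_continuousOn
      ((contDiff_gradient (hc i)).continuous_fderiv (by norm_num)).continuousOn
  choose A hA using h
  refine ⟨∑ i, Θ * A i, fun x hx d μ hμ => ?_⟩
  rw [Finset.sum_mul]
  refine norm_sum_le_of_le _ fun i _ => ?_
  have hΘ : 0 ≤ Θ := (norm_nonneg _).trans hμ
  rw [norm_smul, mul_assoc]
  refine mul_le_mul ((norm_le_pi_norm μ i).trans hμ) ?_ (norm_nonneg _) hΘ
  refine (ContinuousLinearMap.le_opNorm _ _).trans ?_
  rw [LinearIsometryEquiv.norm_map]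
  exact mul_le_mul_of_nonneg_right (hA i x hx) (norm_nonneg _)

end Problem

/-! ### Quadratic bound for the potential along the iterates -/

section Problem
variable {n : ℕ} {E I : Type*} [Fintype E] [Fintype I]

/-- Along a sequence of exact subproblem steps tending to zero, the potential function at
`(x + d, σ x - g, x)` exceeds the limit of the objective values by at most a multiple of `‖d‖²`. -/
theorem exists_potential_bound {f : Vec n → ℝ} {c : E ⊕ I → Vec n → ℝ}
    (hc : ∀ i, ContDiff ℝ 2 (c i)) {D : Set (Vec n)} (hD : IsCompact D) (hf : ContinuousOn f D)
    {σ l κ : ℝ} (hκ0 : 0 < κ) (hκ : κ ≤ 1 / 2)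
    (hKL : IsKLWithExponent (potential f c D σ l) κ) {x g d : ℕ → Vec n}
    {B : ℕ → Vec n →L[ℝ] Vec n} {μ : ℕ → E ⊕ I → ℝ} {G β Θ fs : ℝ} (hx : ∀ k, x k ∈ D)
    (hxd : ∀ k, x k + d k ∈ D) (hg : ∀ k, ‖g k‖ ≤ G) (hB : ∀ k, ‖B k‖ ≤ β)
    (hμ : ∀ k, ‖μ k‖ ≤ Θ) (hμ0 : ∀ k, ∀ i : I, 0 ≤ μ k (Sum.inr i))
    (hfg : ∀ k, ∀ x' ∈ D, f x' ≤ f (x k) + inner ℝ (g k) (x' - x k) + σ / 2 * ‖x' - x k‖ ^ 2)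
    (hstat : ∀ k, g k + B k (d k) - ∑ i, μ k i • gradient (c i) (x k) = 0)
    (hlin : ∀ᶠ k in atTop, (x k + d k, x k) ∈ linFeasible c)
    (hcomp : ∀ᶠ k in atTop, ∀ i, μ k i * linCon c i (x k + d k) (x k) = 0)
    (hfeas : ∀ xbar, MapClusterPt xbar atTop x → xbar ∈ feasibleRegion c)
    (hd : Tendsto d atTop (𝓝 0)) (hfs : Tendsto (fun k => f (x k)) atTop (𝓝 fs)) :
    ∃ C, ∀ᶠ k in atTop,
      f (x k) + inner ℝ (g k) (d k) + (σ + l) / 2 * ‖d k‖ ^ 2 - fs ≤ C * ‖d k‖ ^ 2 := by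
  -- The quadratic upper bound rearranged: `σ • x k - g k` is a subgradient of `F` at `x k`, so
  -- Fenchel equality holds there.
  have hopt : ∀ k, ∀ x' ∈ D, inner ℝ (σ • x k - g k) x' - (-f x' + σ / 2 * ‖x'‖ ^ 2) ≤
      inner ℝ (σ • x k - g k) (x k) - (-f (x k) + σ / 2 * ‖x k‖ ^ 2) := by
    intro k x' hx'
    have h1 := hfg k x' hx'
    rw [norm_sub_sq_real, inner_sub_right, real_inner_comm] at h1
    simp only [inner_sub_left, real_inner_smul_left, real_inner_self_eq_norm_sq]
    rw [real_inner_comm x' (x k)]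
    rw [real_inner_comm] at h1
    linarith
  obtain ⟨A, hA⟩ := exists_norm_adjoint_fderiv_gradient_le hc hD Θ
  obtain ⟨X, hX⟩ := hD.isBounded.exists_norm_le
  have hdn : Tendsto (fun k => ‖d k‖) atTop (𝓝 0) := by simpa using hd.norm
  refine hKL.exists_quadratic_bound hκ0 hκ
    ((hD.prod ((isCompact_closedBall (0 : Vec n) (|σ| * X + G)).prod hD)).image continuous_triple)
    (u := fun k => triple (x k + d k) (σ • x k - g k) (x k))
    (s := fun k => triple (-(σ • x k - g k) + σ • (x k + d k) + l • (x k + d k - x k) -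
      ∑ i, μ k i • gradient (c i) (x k)) (x k - (x k + d k))
        (-(l • (x k + d k - x k)) - ∑ i, μ k i •
          ContinuousLinearMap.adjoint (fderiv ℝ (gradient (c i)) (x k)) (x k + d k - x k)))
    (M := |σ + l| + β + 1 + |l| + A) (Eventually.of_forall fun k => ?_) ?_ ?_ ?_
    (Eventually.of_forall fun k => ?_) hdn ?_
  · refine ⟨(x k + d k, σ • x k - g k, x k), ⟨hxd k, ?_, hx k⟩, rfl⟩
    rw [mem_closedBall_zero_iff]
    refine (norm_sub_le _ _).trans (add_le_add ?_ (hg k))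
    rw [norm_smul, Real.norm_eq_abs]
    exact mul_le_mul_of_nonneg_left (hX _ (hx k)) (abs_nonneg _)
  · filter_upwards [hlin] with k hk
    rw [potential_eq (hx k) (hopt k) hk, EReal.coe_eq_coe_iff, add_sub_cancel_left,
      norm_add_sq_real]
    simp only [inner_sub_left, inner_add_right, real_inner_smul_left]
    ring
  · have hgd : Tendsto (fun k => inner ℝ (g k) (d k)) atTop (𝓝 0) := by
      refine squeeze_zero_norm (fun k => ?_) (by simpa using hdn.const_mul G)
      exact (norm_inner_le_norm _ _).trans (mul_le_mul_of_nonneg_right (hg k) (norm_nonneg _))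
    simpa using (hfs.add hgd).add ((hdn.pow 2).const_mul ((σ + l) / 2))
  · filter_upwards [hlin, hcomp] with k hk hck
    exact mem_regularSubdiff_potential hc (hx k) (hopt k) hk (hμ0 k) hck
  · have hβ0 : 0 ≤ β := (norm_nonneg _).trans (hB 0)
    refine (norm_triple_le _ _ _).trans ?_
    -- Stationarity of the subproblem cancels `g k` against the multiplier term, leaving only terms
    -- linear in `d k`.
    have e1 : -(σ • x k - g k) + σ • (x k + d k) + l • (x k + d k - x k) -
        ∑ i, μ k i • gradient (c i) (x k) = (σ + l) • d k - B k (d k) := by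
      rw [← sub_eq_zero.1 (hstat k), add_sub_cancel_left, smul_add, add_smul]
      abel
    have h1 : ‖(σ + l) • d k - B k (d k)‖ ≤ |σ + l| * ‖d k‖ + β * ‖d k‖ := by
      refine (norm_sub_le _ _).trans (add_le_add (by rw [norm_smul, Real.norm_eq_abs]) ?_)
      exact ((B k).le_opNorm _).trans (mul_le_mul_of_nonneg_right (hB k) (norm_nonneg _))
    have h2 : ‖x k - (x k + d k)‖ = ‖d k‖ := by simp
    have h3 := norm_sub_le (-(l • (x k + d k - x k))) (∑ i, μ k i •
      ContinuousLinearMap.adjoint (fderiv ℝ (gradient (c i)) (x k)) (x k + d k - x k))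
    have h4 := hA (x k) (hx k) (x k + d k - x k) (μ k) (hμ k)
    rw [norm_neg, norm_smul, Real.norm_eq_abs] at h3
    rw [e1, h2]
    rw [add_sub_cancel_left] at h3 h4 ⊢
    linarith
  · intro uh φ hφ hlim
    have hproj : ∀ j : Fin 3, Tendsto
        (fun m => (triple (x (φ m) + d (φ m)) (σ • x (φ m) - g (φ m)) (x (φ m))) j) atTop
        (𝓝 (uh j)) := fun j =>
      ((PiLp.proj 2 (fun _ : Fin 3 => Vec n) j : Triple n →L[ℝ] Vec n).continuous.tendsto
        uh).comp hlim
    have hlim2 : Tendsto (fun m => x (φ m)) atTop (𝓝 (uh 2)) := hproj 2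
    have hlim1 : Tendsto (fun m => σ • x (φ m) - g (φ m)) atTop (𝓝 (uh 1)) := hproj 1
    have hlim0 : Tendsto (fun m => x (φ m) + d (φ m)) atTop (𝓝 (uh 0)) := hproj 0
    -- Since `d` tends to zero, the two primal components coincide in the limit. Feasibility of the
    -- cluster point then puts it in the linearized set, and Fenchel equality passes to the limit,
    -- so the potential equals `f` there.
    have h02 : uh 0 = uh 2 := by
      refine tendsto_nhds_unique hlim0 ?_
      simpa using hlim2.add (hd.comp hφ.tendsto_atTop)
    have hmem : uh 2 ∈ D := hD.isClosed.mem_of_tendsto hlim2 (Eventually.of_forall fun m => hx _)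
    have hfeas2 := hfeas (uh 2) (MapClusterPt.of_comp hφ.tendsto_atTop hlim2.mapClusterPt)
    have hfx : Tendsto (fun m => f (x (φ m))) atTop (𝓝 (f (uh 2))) :=
      (hf (uh 2) hmem).tendsto.comp
        (tendsto_nhdsWithin_iff.2 ⟨hlim2, Eventually.of_forall fun m => hx _⟩)
    have hfeq : f (uh 2) = fs := tendsto_nhds_unique hfx (hfs.comp hφ.tendsto_atTop)
    have hopt2 : ∀ x' ∈ D, inner ℝ (uh 1) x' - (-f x' + σ / 2 * ‖x'‖ ^ 2) ≤
        inner ℝ (uh 1) (uh 2) - (-f (uh 2) + σ / 2 * ‖uh 2‖ ^ 2) := fun x' hx' =>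
      le_of_tendsto_of_tendsto' ((hlim1.inner tendsto_const_nhds).sub tendsto_const_nhds)
        ((hlim1.inner hlim2).sub (hfx.neg.add ((hlim2.norm.pow 2).const_mul _)))
        fun m => hopt (φ m) x' hx'
    have hlinuh : (uh 2, uh 2) ∈ linFeasible c := by
      refine ⟨fun i => ?_, fun i => ?_⟩
      · simpa [linCon] using hfeas2.1 i
      · simpa [linCon] using hfeas2.2 i
    have huh : uh = triple (uh 2) (uh 1) (uh 2) := by
      ext j : 1
      fin_cases j
      · exact h02
      · rfl
      · rfl
    rw [huh, potential_eq hmem hopt2 hlinuh, EReal.coe_eq_coe_iff, sub_self, norm_zero, ← hfeq]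
    ring

end Problem

end NonsmoothSQP

end

/-! ### Assembly: merit decrease against the potential bound -/

theorem mainTheorem6 {n : ℕ} {E I : Type*} [Fintype E] [Fintype I]
    -- the problem data
    (f : NonsmoothSQP.Vec n → ℝ) (c : E ⊕ I → NonsmoothSQP.Vec n → ℝ)
    (O D : Set (NonsmoothSQP.Vec n))
    (hO : IsOpen O) (hDO : D ⊆ O) (hDcompact : IsCompact D) (hDconvex : Convex ℝ D)
    -- the objective is Lipschitz and upper-C², with constant ρ on D
    (hfLip : ∃ K : NNReal, LipschitzOnWith K f O)
    (hfC2 : NonsmoothSQP.UpperC2On f O)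
    (ρ : ℝ) (hρ : 0 < ρ) (hfρ : ConvexOn ℝ D (fun x => -f x + ρ / 2 * ‖x‖ ^ 2))
    -- the constraints are C², with constant H on D
    (hc : ∀ i, ContDiff ℝ 2 (c i))
    (H : ℝ) (hH : 0 ≤ H)
    (hcH : ∀ i, ∀ x ∈ D, ∀ x' ∈ D,
      |c i x' - c i x - inner ℝ (gradient (c i) x) (x' - x)| ≤ H / 2 * ‖x - x'‖ ^ 2)
    -- an infinite run of the algorithm
    (η τ γ : ℝ) (hη : 0 < η ∧ η < 1) (hτ : 0 < τ ∧ τ < 1) (hγ : 0 < γ)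
    (x g d : ℕ → NonsmoothSQP.Vec n) (B : ℕ → NonsmoothSQP.Vec n →L[ℝ] NonsmoothSQP.Vec n)
    (v w : ℕ → E → ℝ) (t : ℕ → I → ℝ) (mult : ℕ → E ⊕ I → ℝ) (θ a : ℕ → ℝ)
    (hrun : NonsmoothSQP.IsSQPRun f c η τ γ x g d B v w t mult θ a)
    -- boundedness of the feasible region and of the subproblem solutions
    (hΩD : NonsmoothSQP.feasibleRegion c ⊆ D)
    (hxD : ∀ k, x k ∈ D ∧ x k + d k ∈ D)
    -- the matrices B_k are bounded and uniformly positive definite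
    (hBbdd : ∃ β : ℝ, ∀ k, ‖B k‖ ≤ β)
    (b : ℝ) (hb : 0 < b) (hBb : ∀ k, ∀ z : NonsmoothSQP.Vec n, b * ‖z‖ ^ 2 ≤ inner ℝ z (B k z))
    -- MFCQ at all accumulation points
    (hMFCQ : ∀ xbar, MapClusterPt xbar Filter.atTop x → NonsmoothSQP.MFCQ c xbar)
    -- b dominates the curvature of the constraints, where c_h = m H
    (cb : ℝ) (hcb : 0 < cb ∧ cb < 1)
    (hBc : ∀ᶠ k in Filter.atTop,
      0 ≤ cb * b - θ k * (((Fintype.card E + Fintype.card I : ℕ) : ℝ) * H))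
    -- relations between the constants
    (σ l : ℝ) (hl : 0 < l) (hbl : l + σ ≤ 2 * b) (hlb : b < l / cb) (hσb : σ ≤ b) (hρσ : ρ ≤ σ)
    -- the potential function is a KL function with exponent κ
    (κ : ℝ) (hκ : 0 < κ ∧ κ ≤ 1 / 2)
    (hKL : NonsmoothSQP.IsKLWithExponent (NonsmoothSQP.potential f c D σ l) κ) :
    ∃ xbar : NonsmoothSQP.Vec n, Filter.Tendsto x Filter.atTop (nhds xbar) ∧
      ∃ q₀ q₁ : ℝ, 0 < q₀ ∧ q₀ < 1 ∧ 0 < q₁ ∧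
        ∀ᶠ k in Filter.atTop, ‖x k - xbar‖ ≤ q₁ * q₀ ^ k := by
  obtain ⟨K, hK⟩ := hfLip
  obtain ⟨β, hβ⟩ := hBbdd
  have hfO : ContinuousOn f O := hK.continuousOn
  have hf : ContinuousOn f D := hfO.mono hDO
  have hx : ∀ k, x k ∈ D := fun k => (hxD k).1
  have hg : ∀ k, ‖g k‖ ≤ K := fun k =>
    NonsmoothSQP.norm_le_of_mem_clarkeSubdiff hO hK (hDO (hx k)) (hrun.subgradient k)
  obtain ⟨X, hX⟩ := hDcompact.isBounded.exists_norm_le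
  have hdX : ∀ k, ‖d k‖ ≤ X + X := fun k => by
    have := norm_sub_le (x k + d k) (x k)
    rw [add_sub_cancel_left] at this
    exact this.trans (add_le_add (hX _ (hxD k).2) (hX _ (hx k)))
  have hfgρ : ∀ k, ∀ x' ∈ D,
      f x' ≤ f (x k) + inner ℝ (g k) (x' - x k) + ρ / 2 * ‖x' - x k‖ ^ 2 := fun k x' hx' =>
    hfC2.le_of_mem_clarkeSubdiff hO hfO hDO hfρ (hx k) hx' (hrun.subgradient k)
  have hfgσ : ∀ k, ∀ x' ∈ D,
      f x' ≤ f (x k) + inner ℝ (g k) (x' - x k) + σ / 2 * ‖x' - x k‖ ^ 2 := fun k x' hx' =>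
    (hfgρ k x' hx').trans (by gcongr)
  -- the penalty parameters converge and the subproblems become exact
  obtain ⟨Θ, hΘ⟩ := hrun.exists_tendsto_penalty hc hDcompact hx hMFCQ hg hβ hdX
  have hθΘ : ∀ k, θ k ≤ Θ := fun k => hrun.penalty_monotone.ge_of_tendsto hΘ k
  have hΘ0 : 0 ≤ Θ := (hrun.penalty_pos.trans_le (hθΘ 0)).le
  have hmultΘ : ∀ k, ‖mult (k + 1)‖ ≤ Θ - γ := fun k => by
    linarith [hrun.norm_mult_add_le k, hθΘ (k + 1)]
  have hmult : ∀ᶠ k in Filter.atTop, ‖mult (k + 1)‖ < θ k := by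
    filter_upwards [hΘ.eventually_const_lt (show Θ - γ < Θ by linarith)] with k hk
    exact (hmultΘ k).trans_lt hk
  have hΘc : Θ * (((Fintype.card E + Fintype.card I : ℕ) : ℝ) * H) ≤ cb * b := by
    refine le_of_tendsto (hΘ.mul_const _) ?_
    filter_upwards [hBc] with k hk
    linarith
  -- sufficient decrease of the merit function with the limiting penalty parameter
  set r := ρ + cb * b with hr
  have hr0 : 0 < r := by have := mul_pos hcb.1 hb; linarith
  -- From `cb * b < l` and `ρ ≤ σ` one gets `r < σ + l ≤ 2 * b`.
  have hrb : r < 2 * b := by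
    have := (lt_div_iff₀ hcb.1).1 hlb
    linarith
  set δ := b - r / 2 with hδ
  have hδ0 : 0 < δ := by linarith
  set Φ : ℕ → ℝ := fun k => NonsmoothSQP.merit f c (x k) Θ with hΦ
  set S : ℕ → ℝ := fun k => Θ * NonsmoothSQP.violation c (x k) - inner ℝ (g k) (d k) -
    inner ℝ (d k) (B k (d k)) with hS
  set amin := min 1 (τ * ((2 - η) * b / r)) with hamin
  have hamin0 : 0 < amin := by
    have h2 : 0 < 2 - η := by linarith [hη.2]
    have := hτ.1
    exact lt_min one_pos (by positivity)
  set δ' := min δ 1 with hδ'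
  have hδ'0 : 0 < δ' := lt_min hδ0 one_pos
  have hSv : ∀ᶠ k in Filter.atTop, γ * NonsmoothSQP.violation c (x k) ≤ S k := by
    filter_upwards [hmult] with k hk
    refine le_trans (mul_le_mul_of_nonneg_right ?_ (NonsmoothSQP.violation_nonneg _ _))
      ((hrun.qp_multiplier k).predicted_decrease_ge (hrun.qp_solution k).1 hk Θ)
    linarith [hmultΘ k]
  -- The acceptance test concerns `θ k`, whereas decrease is needed at the limit `Θ`. As `r < 2 *
  -- b`, the model gives decrease for every step size in `(0, 1]`; the line search supplies only the
  -- lower bound `amin`.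
  have hdec : ∀ᶠ k in Filter.atTop, amin * δ' * (‖d k‖ ^ 2 + S k) ≤ Φ k - Φ (k + 1) := by
    filter_upwards [hmult, hSv, hBc] with k hk hSk hck
    have ha := hrun.stepsize_mem hτ k
    have hamink : amin ≤ a k := hrun.stepsize_ge hη.2 hτ hDconvex hcH hr0 (hfgρ k) (hx k)
      (hxD k).2 (hBb k _) hk (by linarith)
    have h1 := NonsmoothSQP.merit_sub_merit_ge hcH (hfgρ k)
      ((hrun.qp_multiplier k).mem_linFeasible (hrun.qp_solution k).1 hk) ha.1.le ha.2 (hx k)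
      (by rw [← hrun.step k]; exact hx (k + 1)) hΘ0
    rw [← hrun.step k] at h1
    have hS0 : 0 ≤ S k :=
      (mul_nonneg hγ.le (NonsmoothSQP.violation_nonneg _ _)).trans hSk
    have h2 : (ρ + Θ * (((Fintype.card E + Fintype.card I : ℕ) : ℝ) * H)) ≤ r := by linarith
    have h3 := mul_le_mul_of_nonneg_left h2 (show 0 ≤ a k ^ 2 / 2 * ‖d k‖ ^ 2 by positivity)
    have h4 : a k ^ 2 ≤ a k := by nlinarith
    have h5 := mul_le_mul_of_nonneg_right h4 (show 0 ≤ r / 2 * ‖d k‖ ^ 2 by positivity)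
    have h6 := mul_le_mul_of_nonneg_left (hBb k (d k)) ha.1.le
    have h7 : a k * (δ * ‖d k‖ ^ 2 + S k) ≤ Φ k - Φ (k + 1) := by
      simp only [hS, hΦ, hδ]
      linarith
    refine le_trans ?_ h7
    rw [mul_assoc]
    refine mul_le_mul hamink ?_ (by positivity) ha.1.le
    rw [mul_add]
    exact add_le_add (mul_le_mul_of_nonneg_right (min_le_left _ _) (sq_nonneg _))
      (mul_le_of_le_one_left hS0 (min_le_right _ _))
  have hcoef : 0 < amin * δ' := mul_pos hamin0 hδ'0
  -- convergence of the merit values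
  obtain ⟨Fb, hFb⟩ := hDcompact.exists_bound_of_continuousOn hf
  have hΦb : ∀ k, -Fb ≤ Φ k := fun k => by
    have h1 := (abs_le.1 (hFb _ (hx k))).1
    have h2 := mul_nonneg hΘ0 (NonsmoothSQP.violation_nonneg c (x k))
    simp only [hΦ, NonsmoothSQP.merit]
    linarith
  obtain ⟨N, hN⟩ := Filter.eventually_atTop.1 (hdec.and hSv)
  have hS0 : ∀ k ≥ N, 0 ≤ S k := fun k hk =>
    (mul_nonneg hγ.le (NonsmoothSQP.violation_nonneg _ _)).trans (hN k hk).2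
  have hanti : Antitone fun j => Φ (j + N) := antitone_nat_of_succ_le fun j => by
    have h1 := (hN (j + N) (Nat.le_add_left _ _)).1
    have h2 := mul_nonneg hcoef.le
      (add_nonneg (sq_nonneg ‖d (j + N)‖) (hS0 (j + N) (Nat.le_add_left _ _)))
    rw [show j + 1 + N = j + N + 1 by omega]
    linarith
  obtain ⟨Φs, hΦs⟩ : ∃ Φs, Filter.Tendsto Φ Filter.atTop (nhds Φs) := by
    refine ⟨_, (Filter.tendsto_add_atTop_iff_nat N).1 (tendsto_atTop_ciInf hanti ⟨-Fb, ?_⟩)⟩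
    rintro _ ⟨j, rfl⟩
    exact hΦb _
  have hΦge : ∀ᶠ k in Filter.atTop, Φs ≤ Φ k := by
    filter_upwards [Filter.eventually_ge_atTop N] with k hk
    obtain ⟨j, rfl⟩ := Nat.exists_eq_add_of_le' hk
    exact hanti.le_of_tendsto ((Filter.tendsto_add_atTop_iff_nat N).2 hΦs) j
  have hdiff : Filter.Tendsto (fun k => (amin * δ')⁻¹ * (Φ k - Φ (k + 1))) Filter.atTop
      (nhds 0) := by
    simpa using (hΦs.sub ((Filter.tendsto_add_atTop_iff_nat 1).2 hΦs)).const_mul (amin * δ')⁻¹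
  have hsum : ∀ᶠ k in Filter.atTop,
      ‖d k‖ ^ 2 + S k ≤ (amin * δ')⁻¹ * (Φ k - Φ (k + 1)) := by
    filter_upwards [hdec] with k hk
    rwa [← div_eq_inv_mul, le_div_iff₀' hcoef]
  have hS0' : ∀ᶠ k in Filter.atTop, 0 ≤ S k := Filter.eventually_atTop.2 ⟨N, hS0⟩
  have hd2 : Filter.Tendsto (fun k => ‖d k‖ ^ 2) Filter.atTop (nhds 0) := by
    refine squeeze_zero' (Filter.Eventually.of_forall fun k => sq_nonneg _) ?_ hdiff
    filter_upwards [hsum, hS0'] with k hk hk'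
    linarith
  have hd : Filter.Tendsto d Filter.atTop (nhds 0) := by
    rw [tendsto_zero_iff_norm_tendsto_zero]
    simpa using hd2.sqrt
  have hv : Filter.Tendsto (fun k => γ * NonsmoothSQP.violation c (x k)) Filter.atTop
      (nhds 0) := by
    refine squeeze_zero' (Filter.Eventually.of_forall fun k =>
      mul_nonneg hγ.le (NonsmoothSQP.violation_nonneg _ _)) ?_ hdiff
    filter_upwards [hsum, hSv] with k hk hk'
    linarith [sq_nonneg ‖d k‖]
  have hfs : Filter.Tendsto (fun k => f (x k)) Filter.atTop (nhds Φs) := by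
    have := hΦs.sub (hv.const_mul (Θ * γ⁻¹))
    rw [mul_zero, sub_zero] at this
    refine this.congr fun k => ?_
    simp only [hΦ, NonsmoothSQP.merit]
    field_simp
    ring
  -- the Kurdyka-Łojasiewicz inequality
  obtain ⟨C, hC⟩ := NonsmoothSQP.exists_potential_bound hc hDcompact hf hκ.1 hκ.2 hKL hx
    (fun k => (hxD k).2) hg hβ (μ := fun k => mult (k + 1)) (Θ := Θ)
    (fun k => (hmultΘ k).trans (by linarith)) (fun k => (hrun.qp_multiplier k).2.2.1) hfgσ
    (fun k => (hrun.qp_multiplier k).1)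
    (hmult.mono fun k hk => (hrun.qp_multiplier k).mem_linFeasible (hrun.qp_solution k).1 hk)
    (hmult.mono fun k hk => (hrun.qp_multiplier k).mul_linCon_eq_zero (hrun.qp_solution k).1 hk)
    (fun xbar hxbar => (hMFCQ xbar hxbar).1) hd hfs
  refine NonsmoothSQP.exists_tendsto_of_linear_decrease hcoef
    (C := (|C| + β + |σ + l| + 1) * (amin * δ')⁻¹) ?_ ?_ hΦge
  · filter_upwards [hdec, hS0'] with k hk hSk
    refine le_trans (mul_le_mul_of_nonneg_left ?_ hcoef.le) hk
    have ha := hrun.stepsize_mem hτ k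
    rw [hrun.step k, add_sub_cancel_left, norm_smul, Real.norm_eq_abs, abs_of_pos ha.1, mul_pow]
    have : a k ^ 2 ≤ 1 := pow_le_one₀ ha.1.le ha.2
    nlinarith [sq_nonneg ‖d k‖]
  · filter_upwards [hsum, hS0', hC] with k hk hSk hCk
    have hβ0 : 0 ≤ β := (norm_nonneg _).trans (hβ 0)
    have hBd : inner ℝ (d k) (B k (d k)) ≤ β * ‖d k‖ ^ 2 := by
      refine (real_inner_le_norm _ _).trans ?_
      have := ((B k).le_opNorm (d k)).trans (mul_le_mul_of_nonneg_right (hβ k) (norm_nonneg _))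
      nlinarith [norm_nonneg (d k)]
    have h1 : Φ k - Φs ≤ (|C| + β + |σ + l| + 1) * (‖d k‖ ^ 2 + S k) := by
      -- The link between merit and potential: `Φ k` is the potential value plus `S k`, up to terms
      -- quadratic in `d k`.
      have e1 : Φ k = f (x k) + inner ℝ (g k) (d k) + inner ℝ (d k) (B k (d k)) + S k := by
        simp only [hΦ, hS, NonsmoothSQP.merit]
        ring
      have h2 := mul_le_mul_of_nonneg_right (le_abs_self C) (sq_nonneg ‖d k‖)
      have h3 := mul_le_mul_of_nonneg_right (neg_le_abs (σ + l)) (sq_nonneg ‖d k‖)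
      have h4 : 0 ≤ (|C| + β + |σ + l|) * S k := by positivity
      have h5 : 0 ≤ |σ + l| * ‖d k‖ ^ 2 := by positivity
      rw [e1]
      linarith [sq_nonneg ‖d k‖]
    rw [mul_assoc]
    exact h1.trans (mul_le_mul_of_nonneg_left hk (by positivity))
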